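/- Let $A\in\mathbb R^{m\times n}$, $b\in\mathbb R^m$, $\beta,\rho>0$, and $p(x)=\beta\|x\|_1+\rho\sum_{1\le i<j\le n}|x_i-x_j|$ on $\mathbb R^n$. All norms and distances are Euclidean. Consider the clustered lasso problem $$\text{(P)}\quad \min_{x\in\mathbb R^n}\ f(x):=\tfrac12\|Ax-b\|^2+p(x),$$ with solution set $\Omega_p$, and its dual $$\text{(D)}\quad \min_{\xi\in\mathbb R^m,\,u\in\mathbb R^n}\ \Big\{\tfrac12\|\xi\|^2+\langle b,\xi\rangle+p^*(u)\ \Big|\ A^T\xi+u=0\Big\},$$ where $p^*$ is the Fenchel conjugate of $p$. Let $l(\xi,u;x)=\tfrac12\|\xi\|^2+\langle b,\xi\rangle+p^*(u)-\langle x,A^T\xi+u\rangle$ and $\mathcal L_\sigma(\xi,u;x)=l(\xi,u;x)+\tfrac\sigma2\|A^T\xi+u\|^2$, and put $\mathcal T_f(x)=\partial f(x)$, $\mathcal T_l(\xi,u;x)=\{(\xi',u',x')\mid(\xi',u',-x')\in\partial l(\xi,u;x)\}$, where $\partial l$ is the convex subdifferential in $(\xi,u)$ times the concave subdifferential in $x$.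 Then (D) has a unique optimal solution $(\xi^*,u^*)$, and there are constants $a_f>0$ and $a_l>0$ such that, for some $\varepsilon,\varepsilon'>0$, $$\operatorname{dist}(0,\mathcal T_f(x))\le\varepsilon\ \Rightarrow\ \operatorname{dist}(x,\Omega_p)\le a_f\operatorname{dist}(0,\mathcal T_f(x)),\tag{1}$$ $$\operatorname{dist}(0,\mathcal T_l(\xi,u;x))\le\varepsilon'\ \Rightarrow\ \operatorname{dist}\big((\xi,u,x),\{(\xi^*,u^*)\}\times\Omega_p\big)\le a_l\operatorname{dist}(0,\mathcal T_l(\xi,u;x))\tag{2}$$ for all $x$, respectively all $(\xi,u,x)$ (the distance to the empty set being $+\infty$). Let $0<\sigma_0\le\sigma_1\le\cdots$ with $\sigma_k\uparrow\sigma_\infty\le\infty$, and let $(\xi^k,u^k,x^k)_{k\ge0}$ be an infinite sequence generated by the Ssnal algorithm (inexact augmented Lagrangian method for (D)): $\xi^{k+1}$ is an approximate minimizer of $\psi_k(\xi):=\inf_u\mathcal L_{\sigma_k}(\xi,u;x^k)$, and $$u^{k+1}=(x^k/\sigma_k-A^T\xi^{k+1})-\operatorname{Prox}_p(x^k/\sigma_k-A^T\xi^{k+1}),\qquad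 x^{k+1}=x^k-\sigma_k(A^T\xi^{k+1}+u^{k+1}),$$ where $\operatorname{Prox}_p(y)=\operatorname{argmin}_x\{\tfrac12\|x-y\|^2+p(x)\}$. For nonnegative sequences $\epsilon_k,\delta_k,\delta_k'$ with $\sum_k\epsilon_k<\infty$, $\sum_k\delta_k<\infty$, $\delta_k'\to0$, consider the following criteria, each for all $k\ge0$: (A) $\|\nabla\psi_k(\xi^{k+1})\|\le\epsilon_k/\sqrt{\sigma_k}$; (B1) $\|\nabla\psi_k(\xi^{k+1})\|\le\delta_k\sqrt{\sigma_k}\,\|A^T\xi^{k+1}+u^{k+1}\|$; (B2) $\|\nabla\psi_k(\xi^{k+1})\|\le\delta_k'\,\|A^T\xi^{k+1}+u^{k+1}\|$. 1. If (A) holds, then $x^k$ converges to an optimal solution of (P), and $(\xi^k,u^k)$ converges to $(\xi^*,u^*)$. 2. If (A) and (B1) hold, then for every $a_f>0$ that satisfies (1) for some $\varepsilon>0$, one has for all sufficiently large $k$ $$\operatorname{dist}(x^{k+1},\Omega_p)\le\theta_k\operatorname{dist}(x^k,\Omega_p),\qquad \theta_k=\big(a_f(a_f^2+\sigma_k^2)^{-1/2}+2\delta_k\big)(1-\delta_k)^{-1},$$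 and $\theta_k\to\theta_\infty=a_f(a_f^2+\sigma_\infty^2)^{-1/2}<1$ (with $\theta_\infty=0$ if $\sigma_\infty=\infty$). If (B2) holds as well, then for every $a_l>0$ that satisfies (2) for some $\varepsilon'>0$, one has for all sufficiently large $k$ $$\|(\xi^{k+1},u^{k+1})-(\xi^*,u^*)\|\le\theta_k'\|x^{k+1}-x^k\|,\qquad \theta_k'=a_l(1+\delta_k')/\sigma_k,$$ and $\theta_k'\to a_l/\sigma_\infty$ (which is $0$ if $\sigma_\infty=\infty$). -/

import Mathlib

open Filter Topology
open scoped ENNReal Gradient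

noncomputable section

namespace ClusteredLasso

/-- Euclidean space `ℝⁿ`. -/
abbrev E (n : ℕ) : Type := EuclideanSpace ℝ (Fin n)

/-- The space `ℝᵐ × ℝⁿ` of dual variables `(ξ, u)`, with the Euclidean norm. -/
abbrev DualSpace (m n : ℕ) : Type := WithLp 2 (E m × E n)

/-- The space of triples `((ξ, u), x)`, with the Euclidean norm. -/
abbrev TripleSpace (m n : ℕ) : Type := WithLp 2 (DualSpace m n × E n)

section General

variable {F : Type*} [NormedAddCommGroup F] [InnerProductSpace ℝ F]

/-- The Fenchel conjugate `f*(u) = sup_x (⟨x, u⟩ - f x)`, with values in `[-∞, ∞]`. -/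
def conjugate (f : F → ℝ) (u : F) : EReal :=
  ⨆ x : F, ((inner ℝ x u - f x : ℝ) : EReal)

/-- The convex subdifferential `∂f(x)` of an extended-valued function. -/
def subdifferential (f : F → EReal) (x : F) : Set F :=
  {v | ∀ y, f x + ((inner ℝ v (y - x) : ℝ) : EReal) ≤ f y}

/-- The concave subdifferential (set of supergradients) of an extended-valued function. -/
def superdifferential (g : F → EReal) (x : F) : Set F :=
  {v | ∀ y, g y ≤ g x + ((inner ℝ v (y - x) : ℝ) : EReal)}

/-- `z` minimizes `½‖x - y‖² + f x` over all `x`. -/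
def IsProx (f : F → ℝ) (y z : F) : Prop :=
  ∀ x, 1 / 2 * ‖z - y‖ ^ 2 + f z ≤ 1 / 2 * ‖x - y‖ ^ 2 + f x

/-- The proximal mapping `Prox_f(y) = argmin_x {½‖x - y‖² + f x}`. For the clustered lasso
regularizer the minimizer exists and is unique, see `isProx_prox` and `IsProx.eq_prox`. -/
def prox (f : F → ℝ) (y : F) : F :=
  Classical.epsilon (IsProx f y)

/-- `a` is a positive modulus with which the set-valued map `T`, whose set of zeros is `S`,
satisfies the error bound condition at `0`: for some `ε > 0`,
`dist(x, S) ≤ a · dist(0, T x)` whenever `dist(0, T x) ≤ ε`.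
The distance to the empty set is `∞`. -/
def IsErrorBoundModulus (T : F → Set F) (S : Set F) (a : ℝ) : Prop :=
  0 < a ∧ ∃ ε : ℝ, 0 < ε ∧ ∀ x, Metric.infEDist 0 (T x) ≤ ENNReal.ofReal ε →
    Metric.infEDist x S ≤ ENNReal.ofReal a * Metric.infEDist 0 (T x)

end General

section Problem

variable {m n : ℕ}

/-- The clustered lasso regularizer `p(x) = β‖x‖₁ + ρ ∑_{i<j} |x_i - x_j|`. -/
def reg (β ρ : ℝ) (x : E n) : ℝ :=
  β * ∑ i, |x i| + ρ * ∑ i, ∑ j ∈ Finset.Ioi i, |x i - x j|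

/-- The primal objective `f(x) = ½‖Ax - b‖² + p(x)`. -/
def primalObj (A : Matrix (Fin m) (Fin n) ℝ) (b : E m) (β ρ : ℝ) (x : E n) : ℝ :=
  1 / 2 * ‖A.toEuclideanLin x - b‖ ^ 2 + reg β ρ x

/-- The set `Ω_p` of optimal solutions of the primal problem. -/
def primalSolutions (A : Matrix (Fin m) (Fin n) ℝ) (b : E m) (β ρ : ℝ) : Set (E n) :=
  {x | ∀ y, primalObj A b β ρ x ≤ primalObj A b β ρ y}

/-- The dual residual `Aᵀξ + u`. -/
def dualResidual (A : Matrix (Fin m) (Fin n) ℝ) (ξ : E m) (u : E n) : E n :=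
  A.transpose.toEuclideanLin ξ + u

/-- The dual objective `½‖ξ‖² + ⟨b, ξ⟩ + p*(u)`. -/
def dualObj (b : E m) (β ρ : ℝ) (ξ : E m) (u : E n) : EReal :=
  ((1 / 2 * ‖ξ‖ ^ 2 + inner ℝ b ξ : ℝ) : EReal) + conjugate (reg β ρ) u

/-- The set of optimal solutions of the dual problem: minimizers of the dual objective subject
to `Aᵀξ + u = 0`. -/
def dualSolutions (A : Matrix (Fin m) (Fin n) ℝ) (b : E m) (β ρ : ℝ) : Set (DualSpace m n) :=
  {q | dualResidual A q.fst q.snd = 0 ∧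
    ∀ (ξ : E m) (u : E n), dualResidual A ξ u = 0 →
      dualObj b β ρ q.fst q.snd ≤ dualObj b β ρ ξ u}

/-- The Lagrangian `l(ξ, u; x) = ½‖ξ‖² + ⟨b, ξ⟩ + p*(u) - ⟨x, Aᵀξ + u⟩`. -/
def lagrangian (A : Matrix (Fin m) (Fin n) ℝ) (b : E m) (β ρ : ℝ)
    (ξ : E m) (u x : E n) : EReal :=
  dualObj b β ρ ξ u - ((inner ℝ x (dualResidual A ξ u) : ℝ) : EReal)

/-- The augmented Lagrangian `L_σ(ξ, u; x) = l(ξ, u; x) + (σ/2)‖Aᵀξ + u‖²`. -/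
def augLagrangian (A : Matrix (Fin m) (Fin n) ℝ) (b : E m) (β ρ σ : ℝ)
    (ξ : E m) (u x : E n) : EReal :=
  lagrangian A b β ρ ξ u x + ((σ / 2 * ‖dualResidual A ξ u‖ ^ 2 : ℝ) : EReal)

/-- The subproblem function `ψ(ξ) = inf_u L_σ(ξ, u; x)`. The infimum is finite for every `ξ`
when `β, ρ, σ > 0`, so that `EReal.toReal` only changes its type. -/
def subproblemFun (A : Matrix (Fin m) (Fin n) ℝ) (b : E m) (β ρ σ : ℝ) (x : E n)
    (ξ : E m) : ℝ :=
  (⨅ u : E n, augLagrangian A b β ρ σ ξ u x).toReal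

/-- The operator `T_f = ∂f`. -/
def opPrimal (A : Matrix (Fin m) (Fin n) ℝ) (b : E m) (β ρ : ℝ) (x : E n) : Set (E n) :=
  subdifferential (fun y => ((primalObj A b β ρ y : ℝ) : EReal)) x

/-- The operator `T_l(ξ, u; x) = {(ξ', u', x') | (ξ', u', -x') ∈ ∂l(ξ, u; x)}`, where
the subdifferential of the convex-concave function `l` is the product of its convex
subdifferential in `(ξ, u)` and its concave subdifferential in `x`. -/
def opLagrangian (A : Matrix (Fin m) (Fin n) ℝ) (b : E m) (β ρ : ℝ)
    (z : TripleSpace m n) : Set (TripleSpace m n) :=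
  {w | w.fst ∈ subdifferential
        (fun q : DualSpace m n => lagrangian A b β ρ q.fst q.snd z.snd) z.fst ∧
      -w.snd ∈ superdifferential
        (fun y : E n => lagrangian A b β ρ z.fst.fst z.fst.snd y) z.snd}

/-- `a` is a modulus `a_f` of the error bound condition of `T_f` at `0`. -/
def IsPrimalModulus (A : Matrix (Fin m) (Fin n) ℝ) (b : E m) (β ρ : ℝ) (a : ℝ) : Prop :=
  IsErrorBoundModulus (opPrimal A b β ρ) (primalSolutions A b β ρ) a

/-- `a` is a modulus `a_l` of the error bound condition of `T_l` at `0`; the set of zeros is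
the product of the dual and the primal solution sets. -/
def IsLagrangianModulus (A : Matrix (Fin m) (Fin n) ℝ) (b : E m) (β ρ : ℝ) (a : ℝ) : Prop :=
  IsErrorBoundModulus (opLagrangian A b β ρ)
    {z | z.fst ∈ dualSolutions A b β ρ ∧ z.snd ∈ primalSolutions A b β ρ} a

/-- `(ξᵏ, uᵏ, xᵏ)` is an infinite sequence produced by the augmented Lagrangian iteration with
penalty parameters `0 < σ₀ ≤ σ₁ ≤ ⋯`, `σ_k ↑ σ_∞ ≤ ∞`. The point `ξᵏ⁺¹` is an approximate
minimizer of the subproblem function; its quality is prescribed by the stopping criteria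
below. -/
structure IsSsnalSequence (A : Matrix (Fin m) (Fin n) ℝ) (β ρ : ℝ)
    (σ : ℕ → ℝ) (σInf : ℝ≥0∞) (ξ : ℕ → E m) (u x : ℕ → E n) : Prop where
  sigma_pos : 0 < σ 0
  sigma_mono : Monotone σ
  sigma_tendsto : Tendsto (fun k => ENNReal.ofReal (σ k)) atTop (𝓝 σInf)
  u_step : ∀ k, u (k + 1) =
    ((σ k)⁻¹ • x k - A.transpose.toEuclideanLin (ξ (k + 1))) -
      prox (reg β ρ) ((σ k)⁻¹ • x k - A.transpose.toEuclideanLin (ξ (k + 1)))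
  x_step : ∀ k, x (k + 1) = x k - σ k • dualResidual A (ξ (k + 1)) (u (k + 1))

/-- The residual `‖∇ψ_k(ξᵏ⁺¹)‖` of the subproblem at iteration `k`. -/
def subproblemResidual (A : Matrix (Fin m) (Fin n) ℝ) (b : E m) (β ρ : ℝ)
    (σ : ℕ → ℝ) (ξ : ℕ → E m) (x : ℕ → E n) (k : ℕ) : ℝ :=
  ‖∇ (subproblemFun A b β ρ (σ k) (x k)) (ξ (k + 1))‖

/-- Stopping criterion (A). -/
def CriterionA (A : Matrix (Fin m) (Fin n) ℝ) (b : E m) (β ρ : ℝ)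
    (σ : ℕ → ℝ) (ξ : ℕ → E m) (x : ℕ → E n) (ε : ℕ → ℝ) : Prop :=
  (∀ k, 0 ≤ ε k) ∧ Summable ε ∧
    ∀ k, subproblemResidual A b β ρ σ ξ x k ≤ ε k / √(σ k)

/-- Stopping criterion (B1). -/
def CriterionB1 (A : Matrix (Fin m) (Fin n) ℝ) (b : E m) (β ρ : ℝ)
    (σ : ℕ → ℝ) (ξ : ℕ → E m) (u x : ℕ → E n) (δ : ℕ → ℝ) : Prop :=
  (∀ k, 0 ≤ δ k) ∧ Summable δ ∧
    ∀ k, subproblemResidual A b β ρ σ ξ x k ≤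
      δ k * √(σ k) * ‖dualResidual A (ξ (k + 1)) (u (k + 1))‖

/-- Stopping criterion (B2). -/
def CriterionB2 (A : Matrix (Fin m) (Fin n) ℝ) (b : E m) (β ρ : ℝ)
    (σ : ℕ → ℝ) (ξ : ℕ → E m) (u x : ℕ → E n) (δ' : ℕ → ℝ) : Prop :=
  (∀ k, 0 ≤ δ' k) ∧ Tendsto δ' atTop (𝓝 0) ∧
    ∀ k, subproblemResidual A b β ρ σ ξ x k ≤
      δ' k * ‖dualResidual A (ξ (k + 1)) (u (k + 1))‖

/-- `θ_k = (a_f (a_f² + σ_k²)^{-1/2} + 2δ_k)(1 - δ_k)⁻¹`. -/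
def primalRate (a σ δ : ℝ) : ℝ :=
  (a / √(a ^ 2 + σ ^ 2) + 2 * δ) * (1 - δ)⁻¹

/-- `θ_∞ = a_f (a_f² + σ_∞²)^{-1/2}`, which is `0` if `σ_∞ = ∞`. -/
def primalRateLimit (a : ℝ) (σInf : ℝ≥0∞) : ℝ :=
  if σInf = ⊤ then 0 else a / √(a ^ 2 + σInf.toReal ^ 2)

/-- `θ'_k = a_l (1 + δ'_k) / σ_k`. -/
def dualRate (a σ δ' : ℝ) : ℝ :=
  a * (1 + δ') / σ

/-- The limit `a_l / σ_∞` of `θ'_k`, which is `0` if `σ_∞ = ∞`. -/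
def dualRateLimit (a : ℝ) (σInf : ℝ≥0∞) : ℝ :=
  if σInf = ⊤ then 0 else a / σInf.toReal

/-! The proximal mapping of the regularizer is well defined. -/

theorem reg_nonneg {β ρ : ℝ} (hβ : 0 < β) (hρ : 0 < ρ) (x : E n) : 0 ≤ reg β ρ x := by
  unfold reg; positivity

theorem continuous_reg (β ρ : ℝ) : Continuous (reg β ρ : E n → ℝ) := by
  unfold reg; fun_prop

theorem reg_midpoint {β ρ : ℝ} (hβ : 0 < β) (hρ : 0 < ρ) (x y : E n) :
    reg β ρ ((1 / 2 : ℝ) • (x + y)) ≤ 1 / 2 * reg β ρ x + 1 / 2 * reg β ρ y := by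
  have key : ∀ a c : ℝ, |1 / 2 * (a + c)| ≤ 1 / 2 * |a| + 1 / 2 * |c| := fun a c => by
    rw [abs_mul, abs_of_pos (by norm_num : (0 : ℝ) < 1 / 2)]
    linarith [abs_add_le a c]
  have h1 : ∑ i, |((1 / 2 : ℝ) • (x + y)) i| ≤ 1 / 2 * ∑ i, |x i| + 1 / 2 * ∑ i, |y i| := by
    rw [Finset.mul_sum, Finset.mul_sum, ← Finset.sum_add_distrib]
    exact Finset.sum_le_sum fun i _ => by
      rw [PiLp.smul_apply, PiLp.add_apply, smul_eq_mul]; exact key (x i) (y i)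
  have h2 : ∑ i, ∑ j ∈ Finset.Ioi i,
        |((1 / 2 : ℝ) • (x + y)) i - ((1 / 2 : ℝ) • (x + y)) j| ≤
      1 / 2 * ∑ i, ∑ j ∈ Finset.Ioi i, |x i - x j| +
        1 / 2 * ∑ i, ∑ j ∈ Finset.Ioi i, |y i - y j| := by
    simp only [Finset.mul_sum]
    rw [← Finset.sum_add_distrib]
    refine Finset.sum_le_sum fun i _ => ?_
    rw [← Finset.sum_add_distrib]
    refine Finset.sum_le_sum fun j _ => ?_
    have h := key (x i - x j) (y i - y j)
    have e : ((1 / 2 : ℝ) • (x + y)) i - ((1 / 2 : ℝ) • (x + y)) j =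
        1 / 2 * (x i - x j + (y i - y j)) := by
      simp only [PiLp.smul_apply, PiLp.add_apply, smul_eq_mul]; ring
    rw [e]; exact h
  unfold reg
  nlinarith [mul_le_mul_of_nonneg_left h1 hβ.le, mul_le_mul_of_nonneg_left h2 hρ.le]

theorem exists_isProx {β ρ : ℝ} (hβ : 0 < β) (hρ : 0 < ρ) (y : E n) :
    ∃ z, IsProx (reg β ρ) y z := by
  have hc : Continuous fun x : E n => 1 / 2 * ‖x - y‖ ^ 2 + reg β ρ x := by
    have := continuous_reg (n := n) β ρ
    fun_prop
  have ht : Tendsto (fun x : E n => 1 / 2 * ‖x - y‖ ^ 2 + reg β ρ x)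
      (cocompact (E n)) atTop := by
    have h1 : Tendsto (fun x : E n => ‖x‖ - ‖y‖ - 1 / 2) (cocompact (E n)) atTop := by
      simpa [sub_eq_add_neg, add_assoc] using
        tendsto_atTop_add_const_right _ (-‖y‖ + -(1 / 2)) (tendsto_norm_cocompact_atTop (E := E n))
    refine tendsto_atTop_mono (fun x => ?_) h1
    have := norm_sub_norm_le x y
    nlinarith [reg_nonneg hβ hρ x, sq_nonneg (‖x - y‖ - 1)]
  exact hc.exists_forall_le ht

theorem isProx_prox {β ρ : ℝ} (hβ : 0 < β) (hρ : 0 < ρ) (y : E n) :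
    IsProx (reg β ρ) y (prox (reg β ρ) y) :=
  Classical.epsilon_spec (exists_isProx hβ hρ y)

theorem IsProx.eq_prox {β ρ : ℝ} (hβ : 0 < β) (hρ : 0 < ρ) {y z : E n}
    (hz : IsProx (reg β ρ) y z) : z = prox (reg β ρ) y := by
  set w := prox (reg β ρ) y
  have hw : IsProx (reg β ρ) y w := isProx_prox hβ hρ y
  have h1 := hz ((1 / 2 : ℝ) • (z + w))
  have h2 := hw ((1 / 2 : ℝ) • (z + w))
  have h3 := reg_midpoint hβ hρ z w
  have e : (1 / 2 : ℝ) • (z + w) - y = (1 / 2 : ℝ) • ((z - y) + (w - y)) := by module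
  have e1 : ‖(1 / 2 : ℝ) • (z + w) - y‖ ^ 2 = 1 / 4 * ‖(z - y) + (w - y)‖ ^ 2 := by
    rw [e, norm_smul, mul_pow]; norm_num
  have e2 := parallelogram_law_with_norm ℝ (z - y) (w - y)
  have e3 : (z - y) - (w - y) = z - w := by abel
  rw [e3] at e2
  have : ‖z - w‖ = 0 := by nlinarith [norm_nonneg (z - w)]
  exact sub_eq_zero.mp (norm_eq_zero.mp this)

end Problem

end ClusteredLasso

end

open ClusteredLasso

namespace ClusteredLasso

section Sublinear

variable {F : Type*} [NormedAddCommGroup F] [InnerProductSpace ℝ F]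

/-- `p` is the support function of a finite set of vectors. -/
def IsPolyhedralSublinear (p : F → ℝ) : Prop :=
  ∃ S : Finset F, ∀ x, (∀ s ∈ S, inner ℝ x s ≤ p x) ∧ ∃ s ∈ S, inner ℝ x s = p x

/-- `u` is a subgradient at `x` of a sublinear function `p`. -/
def SubgradAt (p : F → ℝ) (x u : F) : Prop :=
  (∀ y, inner ℝ y u ≤ p y) ∧ inner ℝ x u = p x

namespace IsPolyhedralSublinear

variable {p q : F → ℝ}

theorem add (hp : IsPolyhedralSublinear p) (hq : IsPolyhedralSublinear q) :
    IsPolyhedralSublinear fun x => p x + q x := by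
  classical
  obtain ⟨S, hS⟩ := hp
  obtain ⟨T, hT⟩ := hq
  refine ⟨(S ×ˢ T).image fun st => st.1 + st.2, fun x => ⟨fun s hs => ?_, ?_⟩⟩
  · obtain ⟨⟨s, t⟩, hst, rfl⟩ := Finset.mem_image.1 hs
    rw [Finset.mem_product] at hst
    rw [inner_add_right]
    exact add_le_add ((hS x).1 s hst.1) ((hT x).1 t hst.2)
  · obtain ⟨s, hs, hs'⟩ := (hS x).2
    obtain ⟨t, ht, ht'⟩ := (hT x).2
    exact ⟨s + t, Finset.mem_image.2 ⟨(s, t), Finset.mem_product.2 ⟨hs, ht⟩, rfl⟩, by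
      rw [inner_add_right, hs', ht']⟩

theorem const_mul (hp : IsPolyhedralSublinear p) {c : ℝ} (hc : 0 ≤ c) :
    IsPolyhedralSublinear fun x => c * p x := by
  classical
  obtain ⟨S, hS⟩ := hp
  refine ⟨S.image fun s => c • s, fun x => ⟨fun s hs => ?_, ?_⟩⟩
  · obtain ⟨r, hr, rfl⟩ := Finset.mem_image.1 hs
    rw [inner_smul_right]
    exact mul_le_mul_of_nonneg_left ((hS x).1 r hr) hc
  · obtain ⟨s, hs, hs'⟩ := (hS x).2
    exact ⟨c • s, Finset.mem_image_of_mem _ hs, by rw [inner_smul_right, hs']⟩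

theorem zero : IsPolyhedralSublinear fun _ : F => (0 : ℝ) :=
  ⟨{0}, fun x => by simp⟩

theorem sum {ι : Type*} (s : Finset ι) {p : ι → F → ℝ}
    (hp : ∀ i ∈ s, IsPolyhedralSublinear (p i)) :
    IsPolyhedralSublinear fun x => ∑ i ∈ s, p i x := by
  classical
  induction s using Finset.induction_on with
  | empty => simpa using zero
  | insert i s hi ih =>
    simp only [Finset.sum_insert hi]
    exact (hp i (Finset.mem_insert_self i s)).add
      (ih fun j hj => hp j (Finset.mem_insert_of_mem hj))

theorem abs_inner (c : F) : IsPolyhedralSublinear fun x : F => |inner ℝ x c| := by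
  classical
  refine ⟨{c, -c}, fun x => ⟨fun s hs => ?_, ?_⟩⟩
  · rcases Finset.mem_insert.1 hs with rfl | hs
    · exact le_abs_self _
    · rw [Finset.mem_singleton.1 hs, inner_neg_right]
      exact neg_le_abs _
  · rcases abs_choice (inner ℝ x c) with h | h
    · exact ⟨c, by simp, h.symm⟩
    · exact ⟨-c, by simp, by rw [inner_neg_right]; exact h.symm⟩

theorem add_le (hp : IsPolyhedralSublinear p) (x y : F) : p (x + y) ≤ p x + p y := by
  obtain ⟨S, hS⟩ := hp
  obtain ⟨s, hs, hs'⟩ := (hS (x + y)).2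
  rw [← hs', inner_add_left]
  exact add_le_add ((hS x).1 s hs) ((hS y).1 s hs)

theorem smul (hp : IsPolyhedralSublinear p) {t : ℝ} (ht : 0 ≤ t) (x : F) :
    p (t • x) = t * p x := by
  obtain ⟨S, hS⟩ := hp
  obtain ⟨s, hs, hs'⟩ := (hS (t • x)).2
  obtain ⟨r, hr, hr'⟩ := (hS x).2
  apply le_antisymm
  · rw [← hs', real_inner_smul_left]
    exact mul_le_mul_of_nonneg_left ((hS x).1 s hs) ht
  · rw [← hr', ← real_inner_smul_left]
    exact (hS (t • x)).1 r hr

theorem exists_subgradAt (hp : IsPolyhedralSublinear p) (x : F) : ∃ u, SubgradAt p x u := by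
  obtain ⟨S, hS⟩ := hp
  obtain ⟨s, hs, hs'⟩ := (hS x).2
  exact ⟨s, fun y => (hS y).1 s hs, hs'⟩

theorem subgradAt_smul (hp : IsPolyhedralSublinear p) {x u : F} (h : SubgradAt p x u) {t : ℝ}
    (ht : 0 ≤ t) : SubgradAt p (t • x) u :=
  ⟨h.1, by rw [real_inner_smul_left, h.2, hp.smul ht]⟩

/-- First-order optimality: if `z` minimizes `g + p`, and `g` lies below a quadratic function
that touches it at `z` with gradient `v`, then `-v` is a subgradient of `p` at `z`. -/
theorem subgradAt_of_isMin (hp : IsPolyhedralSublinear p) {g : F → ℝ} {z v : F} {C : ℝ}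
    (hg : ∀ x, g x ≤ g z + inner ℝ v (x - z) + C * ‖x - z‖ ^ 2)
    (hz : ∀ x, g z + p z ≤ g x + p x) : SubgradAt p z (-v) := by
  have key : ∀ w : F, ∀ e : ℝ, (∀ t : ℝ, 0 < t → t ≤ 1 → p (z + t • w) ≤ p z + t * e) →
      0 ≤ inner ℝ v w + e := by
    intro w e he
    have h1 : ∀ t : ℝ, t ∈ Set.Ioc (0 : ℝ) 1 →
        0 ≤ inner ℝ v w + e + t * (C * ‖w‖ ^ 2) := by
      intro t ht
      have h2 := hz (z + t • w)
      have h3 := hg (z + t • w)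
      have h4 := he t ht.1 ht.2
      rw [add_sub_cancel_left, inner_smul_right, norm_smul, Real.norm_eq_abs, mul_pow, sq_abs]
        at h3
      refine nonneg_of_mul_nonneg_right (b := _) (a := t) ?_ ht.1
      nlinarith
    have hcont : Tendsto (fun t : ℝ => inner ℝ v w + e + t * (C * ‖w‖ ^ 2)) (𝓝[>] 0)
        (𝓝 (inner ℝ v w + e + 0 * (C * ‖w‖ ^ 2))) :=
      (Continuous.tendsto (by fun_prop) 0).mono_left nhdsWithin_le_nhds
    rw [zero_mul, add_zero] at hcont
    exact ge_of_tendsto hcont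
      (eventually_of_mem (Ioc_mem_nhdsGT (zero_lt_one' ℝ)) h1)
  have h1 : ∀ y, inner ℝ y (-v) ≤ p y := by
    intro y
    have := key y (p y) fun t ht _ => by
      have := hp.add_le z (t • y)
      rwa [hp.smul ht.le] at this
    rw [inner_neg_right, real_inner_comm]
    linarith
  refine ⟨h1, le_antisymm (h1 z) ?_⟩
  have := key (-z) (-p z) fun t ht ht1 => by
    have e : z + t • (-z) = (1 - t) • z := by module
    rw [e, hp.smul (by linarith)]
    linarith
  rw [inner_neg_right] at this
  rw [inner_neg_right, real_inner_comm]
  linarith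

end IsPolyhedralSublinear

theorem SubgradAt.add_inner_le {p : F → ℝ} {x u : F} (h : SubgradAt p x u) (y : F) :
    p x + inner ℝ u (y - x) ≤ p y := by
  have := h.1 y
  rw [inner_sub_right, real_inner_comm x u, h.2, real_inner_comm]
  linarith

theorem SubgradAt.monotone {p : F → ℝ} {x u y v : F} (hx : SubgradAt p x u)
    (hy : SubgradAt p y v) : 0 ≤ inner ℝ (u - v) (x - y) := by
  have h1 := hx.add_inner_le y
  have h2 := hy.add_inner_le x
  rw [← neg_sub x y, inner_neg_right] at h1
  rw [inner_sub_left]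
  linarith

end Sublinear

section Hoffman

variable {F : Type*} [NormedAddCommGroup F] [InnerProductSpace ℝ F] [FiniteDimensional ℝ F]
  {ι : Type*}

/-- On the polar of a polyhedral cone the norm is controlled by the violation of the
inequalities that define the cone. -/
theorem exists_norm_le_sum_of_mem_polar (a : ι → F) (J : Finset ι) :
    ∃ κ : ℝ, 0 ≤ κ ∧ ∀ d : F, (∀ t, (∀ j ∈ J, inner ℝ (a j) t ≤ 0) → inner ℝ d t ≤ 0) →
      ‖d‖ ≤ κ * ∑ j ∈ J, max (inner ℝ (a j) d) 0 := by
  set K : Set F := Metric.sphere 0 1 ∩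
    {d | ∀ t, (∀ j ∈ J, inner ℝ (a j) t ≤ 0) → inner ℝ d t ≤ 0} with hK
  have hKc : IsCompact K := by
    refine (isCompact_sphere 0 1).inter_right ?_
    simp only [Set.ofPred_forall]
    exact isClosed_iInter fun t => isClosed_iInter fun _ =>
      isClosed_le (by fun_prop) continuous_const
  have hnormalize : ∀ d : F, d ≠ 0 →
      (∀ t, (∀ j ∈ J, inner ℝ (a j) t ≤ 0) → inner ℝ d t ≤ 0) → ‖d‖⁻¹ • d ∈ K := by
    intro d hd h
    refine ⟨by simp [norm_smul, hd], fun t ht => ?_⟩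
    rw [real_inner_smul_left]
    exact mul_nonpos_of_nonneg_of_nonpos (by positivity) (h t ht)
  rcases K.eq_empty_or_nonempty with hKe | hKn
  · refine ⟨0, le_rfl, fun d hd => ?_⟩
    by_contra hne
    have hd0 : d ≠ 0 := by rintro rfl; simp at hne
    have := hnormalize d hd0 hd
    simp [hKe] at this
  · have hc : Continuous fun d : F => ∑ j ∈ J, max (inner ℝ (a j) d) 0 := by fun_prop
    obtain ⟨e, heK, he⟩ := hKc.exists_isMinOn hKn hc.continuousOn
    have hpos : 0 < ∑ j ∈ J, max (inner ℝ (a j) e) 0 := by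
      refine lt_of_le_of_ne (Finset.sum_nonneg fun _ _ => le_max_right _ _) fun h0 => ?_
      have h1 := (Finset.sum_eq_zero_iff_of_nonneg fun _ _ => le_max_right _ _).1 h0.symm
      have h2 : inner ℝ e e ≤ 0 :=
        heK.2 e fun j hj => (le_max_left _ _).trans (h1 j hj).le
      have h3 : e = 0 := inner_self_eq_zero.1 (le_antisymm h2 real_inner_self_nonneg)
      have h4 := heK.1
      simp [h3] at h4
    refine ⟨(∑ j ∈ J, max (inner ℝ (a j) e) 0)⁻¹, by positivity, fun d hd => ?_⟩
    rcases eq_or_ne d 0 with rfl | hd0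
    · simp
    have h1 : ∑ j ∈ J, max (inner ℝ (a j) e) 0 ≤
        ∑ j ∈ J, max (inner ℝ (a j) (‖d‖⁻¹ • d)) 0 := he (hnormalize d hd0 hd)
    have h2 : ∑ j ∈ J, max (inner ℝ (a j) (‖d‖⁻¹ • d)) 0 =
        ‖d‖⁻¹ * ∑ j ∈ J, max (inner ℝ (a j) d) 0 := by
      rw [Finset.mul_sum]
      refine Finset.sum_congr rfl fun j _ => ?_
      rw [real_inner_smul_right, mul_max_of_nonneg _ _ (by positivity), mul_zero]
    rw [h2, inv_mul_eq_div, le_div_iff₀ (norm_pos_iff.2 hd0)] at h1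
    rw [inv_mul_eq_div, le_div_iff₀ hpos]
    linarith

/-- Hoffman's lemma: the distance to a nonempty polyhedron is bounded by a multiple of the
violation of the inequalities that define it. -/
theorem hoffman_bound [Fintype ι] (a : ι → F) (c : ι → ℝ)
    (hne : {x : F | ∀ i, inner ℝ (a i) x ≤ c i}.Nonempty) :
    ∃ κ : ℝ, 0 ≤ κ ∧ ∀ x : F, Metric.infDist x {x : F | ∀ i, inner ℝ (a i) x ≤ c i} ≤
      κ * ∑ i, max (inner ℝ (a i) x - c i) 0 := by
  classical
  choose κ hκ0 hκ using exists_norm_le_sum_of_mem_polar a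
  set Q : Set F := {x : F | ∀ i, inner ℝ (a i) x ≤ c i}
  have hQc : IsClosed Q := by
    simp only [Q, Set.ofPred_forall]
    exact isClosed_iInter fun i => isClosed_le (by fun_prop) continuous_const
  have hQconv : Convex ℝ Q := by
    intro x hx y hy s t hs ht hst i
    have h1 := hx i
    have h2 := hy i
    rw [inner_add_right, real_inner_smul_right, real_inner_smul_right]
    calc s * inner ℝ (a i) x + t * inner ℝ (a i) y ≤ s * c i + t * c i := by gcongr
      _ = c i := by rw [← add_mul, hst, one_mul]
  refine ⟨∑ J : Finset ι, κ J, Finset.sum_nonneg fun J _ => hκ0 J, fun x => ?_⟩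
  obtain ⟨z, hzQ, hz⟩ := exists_norm_eq_iInf_of_complete_convex hne hQc.isComplete hQconv x
  rw [norm_eq_iInf_iff_real_inner_le_zero hQconv hzQ] at hz
  set J : Finset ι := Finset.univ.filter fun i => inner ℝ (a i) z = c i with hJ
  have hpolar : ∀ t, (∀ j ∈ J, inner ℝ (a j) t ≤ 0) → inner ℝ (x - z) t ≤ 0 := by
    intro t ht
    have hev : ∀ᶠ s : ℝ in 𝓝[>] 0, ∀ i, inner ℝ (a i) (z + s • t) ≤ c i := by
      rw [eventually_all]
      intro i
      by_cases hi : i ∈ J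
      · filter_upwards [self_mem_nhdsWithin] with s hs
        rw [inner_add_right, real_inner_smul_right, (Finset.mem_filter.1 hi).2]
        have := mul_nonpos_of_nonneg_of_nonpos (le_of_lt hs) (ht i hi)
        linarith
      · have hlt : inner ℝ (a i) z < c i :=
          lt_of_le_of_ne (hzQ i) fun h => hi (Finset.mem_filter.2 ⟨Finset.mem_univ i, h⟩)
        have hc : Tendsto (fun s : ℝ => inner ℝ (a i) (z + s • t)) (𝓝[>] 0)
            (𝓝 (inner ℝ (a i) (z + (0 : ℝ) • t))) :=
          (Continuous.tendsto (by fun_prop) 0).mono_left nhdsWithin_le_nhds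
        rw [zero_smul, add_zero] at hc
        exact (hc.eventually (gt_mem_nhds hlt)).mono fun s hs => le_of_lt hs
    obtain ⟨s, hs, hs0⟩ := (hev.and self_mem_nhdsWithin).exists
    have h := hz (z + s • t) hs
    rw [add_sub_cancel_left, real_inner_smul_right] at h
    exact nonpos_of_mul_nonpos_right h hs0
  calc Metric.infDist x Q ≤ ‖x - z‖ := by
        rw [← dist_eq_norm]; exact Metric.infDist_le_dist_of_mem hzQ
    _ ≤ κ J * ∑ j ∈ J, max (inner ℝ (a j) (x - z)) 0 := hκ J _ hpolar
    _ = κ J * ∑ j ∈ J, max (inner ℝ (a j) x - c j) 0 := by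
        congr 1
        refine Finset.sum_congr rfl fun j hj => ?_
        rw [inner_sub_right, (Finset.mem_filter.1 hj).2]
    _ ≤ (∑ J : Finset ι, κ J) * ∑ i, max (inner ℝ (a i) x - c i) 0 := by
        refine mul_le_mul (Finset.single_le_sum (fun J _ => hκ0 J) (Finset.mem_univ J))
          (Finset.sum_le_sum_of_subset_of_nonneg (Finset.subset_univ _)
            fun _ _ _ => le_max_right _ _)
          (Finset.sum_nonneg fun _ _ => le_max_right _ _)
          (Finset.sum_nonneg fun J _ => hκ0 J)

end Hoffman

section Primal

variable {m n : ℕ} {A : Matrix (Fin m) (Fin n) ℝ} {b : E m} {β ρ : ℝ}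

theorem isPolyhedralSublinear_reg (hβ : 0 < β) (hρ : 0 < ρ) :
    IsPolyhedralSublinear (reg β ρ : E n → ℝ) := by
  have h1 : ∀ i : Fin n, IsPolyhedralSublinear fun x : E n => |x i| := fun i => by
    simpa [EuclideanSpace.inner_single_right] using
      IsPolyhedralSublinear.abs_inner (EuclideanSpace.single i (1 : ℝ))
  have h2 : ∀ i j : Fin n, IsPolyhedralSublinear fun x : E n => |x i - x j| := fun i j => by
    simpa [EuclideanSpace.inner_single_right, inner_sub_right] using
      IsPolyhedralSublinear.abs_inner
        (EuclideanSpace.single i (1 : ℝ) - EuclideanSpace.single j (1 : ℝ))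
  exact ((IsPolyhedralSublinear.sum _ fun i _ => h1 i).const_mul hβ.le).add
    ((IsPolyhedralSublinear.sum _ fun i _ =>
      IsPolyhedralSublinear.sum _ fun j _ => h2 i j).const_mul hρ.le)

theorem mul_norm_le_reg (hβ : 0 < β) (hρ : 0 < ρ) (x : E n) : β * ‖x‖ ≤ reg β ρ x := by
  have h1 : ‖x‖ ≤ ∑ i, |x i| := by
    rw [EuclideanSpace.norm_eq]
    refine Real.sqrt_le_iff.2 ⟨by positivity, ?_⟩
    exact Finset.sum_sq_le_sq_sum_of_nonneg fun i _ => abs_nonneg _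
  unfold reg
  have : 0 ≤ ρ * ∑ i, ∑ j ∈ Finset.Ioi i, |x i - x j| := by positivity
  have := mul_le_mul_of_nonneg_left h1 hβ.le
  linarith

theorem inner_toEuclideanLin_left (A : Matrix (Fin m) (Fin n) ℝ) (x : E n) (y : E m) :
    inner ℝ (A.toEuclideanLin x) y = inner ℝ x (A.transpose.toEuclideanLin y) := by
  rw [← Matrix.conjTranspose_eq_transpose_of_trivial,
    Matrix.toEuclideanLin_conjTranspose_eq_adjoint, LinearMap.adjoint_inner_right]

theorem exists_norm_toEuclideanLin_le (A : Matrix (Fin m) (Fin n) ℝ) :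
    ∃ C : ℝ, 0 ≤ C ∧ ∀ x, ‖A.toEuclideanLin x‖ ≤ C * ‖x‖ :=
  ⟨‖LinearMap.toContinuousLinearMap A.toEuclideanLin‖, norm_nonneg _,
    (LinearMap.toContinuousLinearMap A.toEuclideanLin).le_opNorm⟩

theorem continuous_toEuclideanLin (A : Matrix (Fin m) (Fin n) ℝ) :
    Continuous A.toEuclideanLin :=
  LinearMap.continuous_of_finiteDimensional _

theorem half_sq_norm_add {F : Type*} [NormedAddCommGroup F] [InnerProductSpace ℝ F] (z d : F) :
    1 / 2 * ‖z + d‖ ^ 2 = 1 / 2 * ‖z‖ ^ 2 + inner ℝ z d + 1 / 2 * ‖d‖ ^ 2 := by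
  rw [norm_add_sq_real]; ring

/-- Second-order expansion of the least squares term. -/
theorem leastSquares_expand (A : Matrix (Fin m) (Fin n) ℝ) (b : E m) (z x : E n) :
    1 / 2 * ‖A.toEuclideanLin x - b‖ ^ 2 = 1 / 2 * ‖A.toEuclideanLin z - b‖ ^ 2 +
      inner ℝ (A.transpose.toEuclideanLin (A.toEuclideanLin z - b)) (x - z) +
      1 / 2 * ‖A.toEuclideanLin (x - z)‖ ^ 2 := by
  have e : A.toEuclideanLin x - b = (A.toEuclideanLin z - b) + A.toEuclideanLin (x - z) := by
    rw [map_sub]; abel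
  rw [e, half_sq_norm_add, real_inner_comm, inner_toEuclideanLin_left, real_inner_comm]

theorem mem_opPrimal_iff {x v : E n} : v ∈ opPrimal A b β ρ x ↔
    ∀ y, primalObj A b β ρ x + inner ℝ v (y - x) ≤ primalObj A b β ρ y := by
  simp only [opPrimal, subdifferential, Set.mem_ofPred_eq, ← EReal.coe_add, EReal.coe_le_coe_iff]

theorem SubgradAt.mem_opPrimal {x u : E n} (h : SubgradAt (reg β ρ) x u) :
    A.transpose.toEuclideanLin (A.toEuclideanLin x - b) + u ∈ opPrimal A b β ρ x := by
  rw [mem_opPrimal_iff]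
  intro y
  have h1 := h.add_inner_le y
  have h2 := leastSquares_expand A b x y
  rw [inner_add_left]
  unfold primalObj
  nlinarith [sq_nonneg ‖A.toEuclideanLin (y - x)‖]

theorem continuous_primalObj (A : Matrix (Fin m) (Fin n) ℝ) (b : E m) (β ρ : ℝ) :
    Continuous (primalObj A b β ρ) := by
  have h1 := continuous_reg (n := n) β ρ
  have h2 := continuous_toEuclideanLin A
  unfold primalObj
  fun_prop

theorem mul_norm_le_primalObj (hβ : 0 < β) (hρ : 0 < ρ) (x : E n) :
    β * ‖x‖ ≤ primalObj A b β ρ x := by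
  have := mul_norm_le_reg hβ hρ x
  unfold primalObj
  nlinarith [sq_nonneg ‖A.toEuclideanLin x - b‖]

/-- The proximal regularization of the primal objective attains its minimum. -/
theorem exists_forall_primalObj_add_le (A : Matrix (Fin m) (Fin n) ℝ) (b : E m) (hβ : 0 < β)
    (hρ : 0 < ρ) {c : ℝ} (hc : 0 ≤ c) (x : E n) :
    ∃ z, ∀ y, primalObj A b β ρ z + c * ‖z - x‖ ^ 2 ≤
      primalObj A b β ρ y + c * ‖y - x‖ ^ 2 := by
  have hcont : Continuous fun z => primalObj A b β ρ z + c * ‖z - x‖ ^ 2 := by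
    have := continuous_primalObj A b β ρ
    fun_prop
  refine hcont.exists_forall_le ?_
  refine tendsto_atTop_mono (fun z => ?_)
    ((tendsto_norm_cocompact_atTop (E := E n)).const_mul_atTop hβ)
  have := mul_norm_le_primalObj (A := A) (b := b) hβ hρ z
  have : 0 ≤ c * ‖z - x‖ ^ 2 := by positivity
  linarith

theorem primalSolutions_nonempty (A : Matrix (Fin m) (Fin n) ℝ) (b : E m) (hβ : 0 < β)
    (hρ : 0 < ρ) : (primalSolutions A b β ρ).Nonempty := by
  obtain ⟨z, hz⟩ := exists_forall_primalObj_add_le A b hβ hρ le_rfl 0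
  exact ⟨z, fun y => by simpa using hz y⟩

theorem isClosed_primalSolutions (A : Matrix (Fin m) (Fin n) ℝ) (b : E m) (β ρ : ℝ) :
    IsClosed (primalSolutions A b β ρ) := by
  have := continuous_primalObj A b β ρ
  simp only [primalSolutions, Set.ofPred_forall]
  exact isClosed_iInter fun y => isClosed_le (by fun_prop) continuous_const

theorem exists_mem_primalSolutions_norm_sub_eq (A : Matrix (Fin m) (Fin n) ℝ) (b : E m)
    (hβ : 0 < β) (hρ : 0 < ρ) (x : E n) : ∃ y ∈ primalSolutions A b β ρ,
      Metric.infDist x (primalSolutions A b β ρ) = ‖x - y‖ := by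
  obtain ⟨y, hy, h⟩ := (isClosed_primalSolutions A b β ρ).exists_infDist_eq_dist
    (primalSolutions_nonempty A b hβ hρ) x
  exact ⟨y, hy, by rw [h, dist_eq_norm]⟩

/-- A proximal step on the primal objective solves the proximal inclusion. -/
theorem exists_proximal_step (A : Matrix (Fin m) (Fin n) ℝ) (b : E m) (hβ : 0 < β) (hρ : 0 < ρ)
    {s : ℝ} (hs : 0 ≤ s) (x : E n) : ∃ z w, SubgradAt (reg β ρ) z w ∧
      s • (x - z) = A.transpose.toEuclideanLin (A.toEuclideanLin z - b) + w := by
  obtain ⟨z, hz⟩ := exists_forall_primalObj_add_le A b hβ hρ (c := 1 / 2 * s) (by positivity) x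
  obtain ⟨C, hC0, hC⟩ := exists_norm_toEuclideanLin_le A
  refine ⟨z, _, (isPolyhedralSublinear_reg hβ hρ).subgradAt_of_isMin
    (g := fun y => 1 / 2 * ‖A.toEuclideanLin y - b‖ ^ 2 + 1 / 2 * s * ‖y - x‖ ^ 2)
    (v := A.transpose.toEuclideanLin (A.toEuclideanLin z - b) - s • (x - z))
    (C := 1 / 2 * C ^ 2 + 1 / 2 * s) (fun y => ?_) (fun y => ?_), ?_⟩
  · have h1 := leastSquares_expand A b z y
    have h2 : 1 / 2 * ‖y - x‖ ^ 2 =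
        1 / 2 * ‖z - x‖ ^ 2 + inner ℝ (z - x) (y - z) + 1 / 2 * ‖y - z‖ ^ 2 := by
      rw [← half_sq_norm_add]; congr 3; abel
    have h3 : ‖A.toEuclideanLin (y - z)‖ ^ 2 ≤ C ^ 2 * ‖y - z‖ ^ 2 := by
      rw [← mul_pow]; exact pow_le_pow_left₀ (norm_nonneg _) (hC _) 2
    have h4 : inner ℝ (s • (x - z)) (y - z) = - (s * inner ℝ (z - x) (y - z)) := by
      rw [real_inner_smul_left, ← neg_sub z x, inner_neg_left]; ring
    have h5 : s * (1 / 2 * ‖y - x‖ ^ 2) = s * (1 / 2 * ‖z - x‖ ^ 2) +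
        s * inner ℝ (z - x) (y - z) + s * (1 / 2 * ‖y - z‖ ^ 2) := by rw [h2]; ring
    rw [inner_sub_left, h4]
    linarith
  · have := hz y
    unfold primalObj at this
    linarith
  · abel

/-- At a primal solution the negative gradient of the least squares term is a subgradient of
the regularizer. -/
theorem subgradAt_of_mem_primalSolutions (hβ : 0 < β) (hρ : 0 < ρ) {x : E n}
    (hx : x ∈ primalSolutions A b β ρ) :
    SubgradAt (reg β ρ) x (-A.transpose.toEuclideanLin (A.toEuclideanLin x - b)) := by
  obtain ⟨C, hC0, hC⟩ := exists_norm_toEuclideanLin_le A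
  refine (isPolyhedralSublinear_reg hβ hρ).subgradAt_of_isMin
    (g := fun y => 1 / 2 * ‖A.toEuclideanLin y - b‖ ^ 2)
    (C := 1 / 2 * C ^ 2) (fun y => ?_) hx
  have h1 := leastSquares_expand A b x y
  have h3 : ‖A.toEuclideanLin (y - x)‖ ^ 2 ≤ C ^ 2 * ‖y - x‖ ^ 2 := by
    rw [← mul_pow]; exact pow_le_pow_left₀ (norm_nonneg _) (hC _) 2
  linarith

/-- Linear regularity of the polyhedron `{x | A x = A z, p x ≤ p z}` of solutions. -/
theorem exists_infDist_primalSolutions_le (hβ : 0 < β) (hρ : 0 < ρ) {z : E n}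
    (hz : z ∈ primalSolutions A b β ρ) : ∃ κ : ℝ, 0 ≤ κ ∧ ∀ x,
      Metric.infDist x (primalSolutions A b β ρ) ≤
        κ * (‖A.toEuclideanLin (x - z)‖ + max (reg β ρ x - reg β ρ z) 0) := by
  obtain ⟨S, hS⟩ := isPolyhedralSublinear_reg (n := n) hβ hρ
  let r : Fin m → E n := fun i => A.transpose.toEuclideanLin (EuclideanSpace.single i 1)
  have hr : ∀ i x, inner ℝ (r i) x = A.toEuclideanLin x i := fun i x => by
    rw [real_inner_comm, ← inner_toEuclideanLin_left]
    simp [EuclideanSpace.inner_single_right]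
  let a : (Fin m ⊕ Fin m) ⊕ S → E n := Sum.elim (Sum.elim r fun i => -r i) fun s => s
  let c : (Fin m ⊕ Fin m) ⊕ S → ℝ :=
    Sum.elim (Sum.elim (fun i => inner ℝ (r i) z) fun i => -inner ℝ (r i) z)
      fun _ => reg β ρ z
  have hza : ∀ i, inner ℝ (a i) z ≤ c i := by
    rintro ((i | i) | s)
    · exact le_rfl
    · exact (inner_neg_left _ _).le
    · exact (real_inner_comm _ _).le.trans ((hS z).1 s s.2)
  obtain ⟨κ, hκ0, hκ⟩ := hoffman_bound a c ⟨z, hza⟩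
  have hsub : {x : E n | ∀ i, inner ℝ (a i) x ≤ c i} ⊆ primalSolutions A b β ρ := by
    intro x hx y
    refine le_trans ?_ (hz y)
    have h1 : A.toEuclideanLin x = A.toEuclideanLin z := by
      ext i
      rw [← hr, ← hr]
      refine le_antisymm (hx (Sum.inl (Sum.inl i))) ?_
      have := hx (Sum.inl (Sum.inr i))
      simp only [a, c, Sum.elim_inl, Sum.elim_inr, inner_neg_left] at this
      linarith
    have h2 : reg β ρ x ≤ reg β ρ z := by
      obtain ⟨s, hs, hs'⟩ := (hS x).2
      rw [← hs', real_inner_comm]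
      exact hx (Sum.inr ⟨s, hs⟩)
    unfold primalObj
    rw [h1]
    linarith
  refine ⟨κ * (2 * m + S.card), by positivity, fun x => ?_⟩
  refine (Metric.infDist_le_infDist_of_subset hsub ⟨z, hza⟩).trans ((hκ x).trans ?_)
  rw [mul_assoc]
  refine mul_le_mul_of_nonneg_left ?_ hκ0
  set t := ‖A.toEuclideanLin (x - z)‖
  set g := max (reg β ρ x - reg β ρ z) 0
  have ht : 0 ≤ t := norm_nonneg _
  have hg : 0 ≤ g := le_max_right _ _
  have hri : ∀ i, |inner ℝ (r i) x - inner ℝ (r i) z| ≤ t := fun i => by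
    rw [hr, hr]
    have := PiLp.norm_apply_le (A.toEuclideanLin (x - z)) i
    rwa [map_sub, PiLp.sub_apply, Real.norm_eq_abs, ← map_sub] at this
  have h1 : ∀ i, max (inner ℝ (a i) x - c i) 0 ≤ t + g := by
    rintro ((i | i) | s)
    · refine max_le ?_ (by positivity)
      have := le_abs_self (inner ℝ (r i) x - inner ℝ (r i) z)
      have := hri i
      simp only [a, c, Sum.elim_inl]
      linarith
    · refine max_le ?_ (by positivity)
      have := neg_abs_le (inner ℝ (r i) x - inner ℝ (r i) z)
      have := hri i
      simp only [a, c, Sum.elim_inl, Sum.elim_inr, inner_neg_left]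
      linarith
    · refine max_le ?_ (by positivity)
      have h1 := (hS x).1 s s.2
      have h2 : reg β ρ x - reg β ρ z ≤ g := le_max_left _ _
      rw [real_inner_comm] at h1
      simp only [a, c, Sum.elim_inr]
      linarith
  calc ∑ i, max (inner ℝ (a i) x - c i) 0 ≤ ∑ i : (Fin m ⊕ Fin m) ⊕ S, (t + g) :=
        Finset.sum_le_sum fun i _ => h1 i
    _ = (2 * m + S.card) * (t + g) := by
        simp; ring

/-- Quadratic growth of the primal objective on its sublevel sets. -/
theorem exists_sq_infDist_le (A : Matrix (Fin m) (Fin n) ℝ) (b : E m) (hβ : 0 < β) (hρ : 0 < ρ)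
    {z : E n} (hz : z ∈ primalSolutions A b β ρ) (M : ℝ) : ∃ K : ℝ, 0 ≤ K ∧ ∀ x,
      primalObj A b β ρ x - primalObj A b β ρ z ≤ M →
      Metric.infDist x (primalSolutions A b β ρ) ^ 2 ≤
        K * (primalObj A b β ρ x - primalObj A b β ρ z) := by
  obtain ⟨κ, hκ0, hκ⟩ := exists_infDist_primalSolutions_le hβ hρ hz
  set C := ‖A.toEuclideanLin z - b‖
  have hC : 0 ≤ C := norm_nonneg _
  refine ⟨κ ^ 2 * (4 * (1 + C) ^ 2 + 2 * |M|), by positivity, fun x hx => ?_⟩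
  have hD0 := sub_nonneg.2 (hz x)
  set D := primalObj A b β ρ x - primalObj A b β ρ z with hD
  set t := ‖A.toEuclideanLin (x - z)‖
  have ht : 0 ≤ t := norm_nonneg _
  have h1 := leastSquares_expand A b z x
  have h2 := (subgradAt_of_mem_primalSolutions hβ hρ hz).add_inner_le x
  rw [inner_neg_left] at h2
  have h3 : |inner ℝ (A.transpose.toEuclideanLin (A.toEuclideanLin z - b)) (x - z)| ≤ C * t := by
    rw [real_inner_comm, ← inner_toEuclideanLin_left, real_inner_comm]
    exact abs_real_inner_le_norm _ _
  have h4 := abs_le.1 h3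
  have hDt : t ^ 2 ≤ 2 * D := by simp only [hD, primalObj]; linarith
  have hp : max (reg β ρ x - reg β ρ z) 0 ≤ D + C * t := by
    refine max_le ?_ (by positivity)
    simp only [hD, primalObj]
    nlinarith [sq_nonneg t]
  have h5 : Metric.infDist x (primalSolutions A b β ρ) ≤ κ * ((1 + C) * t + D) :=
    (hκ x).trans (mul_le_mul_of_nonneg_left (by linarith) hκ0)
  have h6 : D ^ 2 ≤ |M| * D := by
    rw [sq]; exact mul_le_mul_of_nonneg_right (hx.trans (le_abs_self M)) hD0
  calc Metric.infDist x (primalSolutions A b β ρ) ^ 2 ≤ (κ * ((1 + C) * t + D)) ^ 2 :=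
        pow_le_pow_left₀ Metric.infDist_nonneg h5 2
    _ = κ ^ 2 * ((1 + C) * t + D) ^ 2 := mul_pow _ _ _
    _ ≤ κ ^ 2 * ((4 * (1 + C) ^ 2 + 2 * |M|) * D) := by
        refine mul_le_mul_of_nonneg_left ?_ (sq_nonneg κ)
        have h7 : (1 + C) ^ 2 * t ^ 2 ≤ (1 + C) ^ 2 * (2 * D) :=
          mul_le_mul_of_nonneg_left hDt (sq_nonneg _)
        nlinarith [sq_nonneg ((1 + C) * t - D)]
    _ = _ := by ring

/-- The error bound for the subdifferential of the primal objective. -/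
theorem exists_infDist_le_of_mem_opPrimal (A : Matrix (Fin m) (Fin n) ℝ) (b : E m) (hβ : 0 < β)
    (hρ : 0 < ρ) : ∃ a : ℝ, 0 < a ∧ ∀ x, ∀ v ∈ opPrimal A b β ρ x, ‖v‖ ≤ β / 2 →
      Metric.infDist x (primalSolutions A b β ρ) ≤ a * ‖v‖ := by
  obtain ⟨z, hz⟩ := primalSolutions_nonempty A b hβ hρ
  set f₀ := primalObj A b β ρ z
  have hf₀ : 0 ≤ f₀ := le_trans (by positivity) (mul_norm_le_primalObj hβ hρ z)
  obtain ⟨K, hK0, hK⟩ := exists_sq_infDist_le A b hβ hρ hz (f₀ + β * ‖z‖)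
  refine ⟨K + 1, by positivity, fun x v hv hvβ => ?_⟩
  rw [mem_opPrimal_iff] at hv
  have hle : ∀ y, primalObj A b β ρ x - primalObj A b β ρ y ≤ ‖v‖ * ‖x - y‖ := fun y => by
    have h1 := hv y
    have h2 := real_inner_le_norm v (x - y)
    rw [← neg_sub x y, inner_neg_right] at h1
    linarith
  have hM : primalObj A b β ρ x - f₀ ≤ f₀ + β * ‖z‖ := by
    have h1 := hle z
    have h2 := mul_norm_le_primalObj (A := A) (b := b) hβ hρ x
    have h3 : ‖v‖ * ‖x - z‖ ≤ β / 2 * (‖x‖ + ‖z‖) :=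
      mul_le_mul hvβ (norm_sub_le x z) (norm_nonneg _) (by positivity)
    linarith
  obtain ⟨y, hy, hxy⟩ := exists_mem_primalSolutions_norm_sub_eq A b hβ hρ x
  have hyz : primalObj A b β ρ y = f₀ := le_antisymm (hy z) (hz y)
  have h1 := hK x hM
  have h2 := hle y
  rw [hyz] at h2
  rw [hxy] at h1 ⊢
  rcases eq_or_lt_of_le (norm_nonneg (x - y)) with h0 | h0
  · rw [← h0]; positivity
  · refine le_of_mul_le_mul_right ?_ h0
    have h3 := mul_le_mul_of_nonneg_left h2 hK0
    nlinarith [mul_nonneg (norm_nonneg v) (norm_nonneg (x - y))]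

theorem infEDist_eq_ofReal_infDist {X : Type*} [PseudoMetricSpace X] {s : Set X}
    (hs : s.Nonempty) (x : X) : Metric.infEDist x s = ENNReal.ofReal (Metric.infDist x s) :=
  (ENNReal.ofReal_toReal (Metric.infEDist_ne_top hs)).symm

/-- A pointwise bound in terms of the elements of `T x` gives an error bound modulus. -/
theorem isErrorBoundModulus_of_forall_mem {F : Type*} [NormedAddCommGroup F]
    [InnerProductSpace ℝ F] {T : F → Set F} {S : Set F} {a ε : ℝ} (ha : 0 < a) (hε : 0 < ε)
    (hS : S.Nonempty) (h : ∀ x, ∀ v ∈ T x, ‖v‖ ≤ ε → Metric.infDist x S ≤ a * ‖v‖) :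
    IsErrorBoundModulus T S a := by
  refine ⟨ha, ε / 2, half_pos hε, fun x hx => ?_⟩
  have hT : (T x).Nonempty := by
    by_contra hne
    rw [Set.not_nonempty_iff_eq_empty.1 hne, Metric.infEDist_empty] at hx
    exact absurd hx (not_le.2 ENNReal.ofReal_lt_top)
  rw [infEDist_eq_ofReal_infDist hT] at hx
  rw [infEDist_eq_ofReal_infDist hT, infEDist_eq_ofReal_infDist hS, ← ENNReal.ofReal_mul ha.le]
  refine ENNReal.ofReal_le_ofReal ?_
  have hd := (ENNReal.ofReal_le_ofReal_iff (half_pos hε).le).1 hx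
  by_contra! hlt
  obtain ⟨v, hv, hvr⟩ := (Metric.infDist_lt_iff (x := 0)
    (r := min (Metric.infDist x S / a) ε) hT).1
    (lt_min ((lt_div_iff₀' ha).2 hlt) (by linarith))
  rw [dist_zero_left, lt_min_iff, lt_div_iff₀' ha] at hvr
  exact absurd (h x v hv hvr.2.le) (not_le.2 hvr.1)

theorem IsErrorBoundModulus.infDist_le {F : Type*} [NormedAddCommGroup F]
    [InnerProductSpace ℝ F] {T : F → Set F} {S : Set F} {a : ℝ} (h : IsErrorBoundModulus T S a)
    (hS : S.Nonempty) : ∃ ε : ℝ, 0 < ε ∧ ∀ x, ∀ v ∈ T x, ‖v‖ ≤ ε →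
      Metric.infDist x S ≤ a * ‖v‖ := by
  obtain ⟨ha, ε, hε, h⟩ := h
  refine ⟨ε, hε, fun x v hv hvε => ?_⟩
  have h1 : Metric.infEDist 0 (T x) ≤ ENNReal.ofReal ‖v‖ := by
    refine (Metric.infEDist_le_edist_of_mem hv).trans ?_
    rw [edist_dist, dist_zero_left]
  have h2 := (h x (h1.trans (ENNReal.ofReal_le_ofReal hvε))).trans (mul_le_mul_right h1 (ENNReal.ofReal a))
  rw [← ENNReal.ofReal_mul ha.le, infEDist_eq_ofReal_infDist hS] at h2
  exact (ENNReal.ofReal_le_ofReal_iff (by positivity)).1 h2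

theorem exists_isPrimalModulus (A : Matrix (Fin m) (Fin n) ℝ) (b : E m) (hβ : 0 < β)
    (hρ : 0 < ρ) : ∃ a, IsPrimalModulus A b β ρ a := by
  obtain ⟨a, ha, h⟩ := exists_infDist_le_of_mem_opPrimal A b hβ hρ
  exact ⟨a, isErrorBoundModulus_of_forall_mem ha (half_pos hβ)
    (primalSolutions_nonempty A b hβ hρ) h⟩

end Primal

section Dual

variable {m n : ℕ} {A : Matrix (Fin m) (Fin n) ℝ} {b : E m} {β ρ : ℝ}

/-- The unit ball of the norm dual to the regularizer, which is the effective domain of its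
Fenchel conjugate. -/
def dualBall (n : ℕ) (β ρ : ℝ) : Set (E n) :=
  {u | ∀ y, inner ℝ y u ≤ reg β ρ y}

theorem conjugate_reg_of_mem (hβ : 0 < β) (hρ : 0 < ρ) {u : E n} (hu : u ∈ dualBall n β ρ) :
    conjugate (reg β ρ) u = 0 := by
  apply le_antisymm
  · refine iSup_le fun x => ?_
    exact_mod_cast sub_nonpos.2 (hu x)
  · refine le_trans ?_ (le_iSup _ (0 : E n))
    have := (isPolyhedralSublinear_reg (n := n) hβ hρ).smul le_rfl (0 : E n)
    rw [zero_smul, zero_mul] at this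
    simp [this]

theorem conjugate_reg_of_notMem (hβ : 0 < β) (hρ : 0 < ρ) {u : E n}
    (hu : u ∉ dualBall n β ρ) : conjugate (reg β ρ) u = ⊤ := by
  simp only [dualBall, Set.mem_ofPred_eq, not_forall, not_le] at hu
  obtain ⟨y, hy⟩ := hu
  rw [EReal.eq_top_iff_forall_lt]
  intro c
  set d := inner ℝ y u - reg β ρ y
  have hd : 0 < d := sub_pos.2 hy
  have ht : 0 ≤ (|c| + 1) / d := by positivity
  refine lt_of_lt_of_le ?_ (le_iSup _ (((|c| + 1) / d) • y))
  rw [EReal.coe_lt_coe_iff, real_inner_smul_left,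
    (isPolyhedralSublinear_reg hβ hρ).smul ht, ← mul_sub]
  change c < (|c| + 1) / d * d
  rw [div_mul_cancel₀ _ hd.ne']
  linarith [le_abs_self c]

theorem dualObj_of_mem (hβ : 0 < β) (hρ : 0 < ρ) (ξ : E m) {u : E n}
    (hu : u ∈ dualBall n β ρ) :
    dualObj b β ρ ξ u = ((1 / 2 * ‖ξ‖ ^ 2 + inner ℝ b ξ : ℝ) : EReal) := by
  rw [dualObj, conjugate_reg_of_mem hβ hρ hu, add_zero]

theorem dualObj_of_notMem (hβ : 0 < β) (hρ : 0 < ρ) (ξ : E m) {u : E n}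
    (hu : u ∉ dualBall n β ρ) : dualObj b β ρ ξ u = ⊤ := by
  rw [dualObj, conjugate_reg_of_notMem hβ hρ hu, EReal.coe_add_top]

theorem lagrangian_of_mem (hβ : 0 < β) (hρ : 0 < ρ) (ξ : E m) {u : E n}
    (hu : u ∈ dualBall n β ρ) (x : E n) : lagrangian A b β ρ ξ u x =
      ((1 / 2 * ‖ξ‖ ^ 2 + inner ℝ b ξ - inner ℝ x (dualResidual A ξ u) : ℝ) : EReal) := by
  rw [lagrangian, dualObj_of_mem hβ hρ ξ hu, EReal.coe_sub]

theorem lagrangian_of_notMem (hβ : 0 < β) (hρ : 0 < ρ) (ξ : E m) {u : E n}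
    (hu : u ∉ dualBall n β ρ) (x : E n) : lagrangian A b β ρ ξ u x = ⊤ := by
  rw [lagrangian, dualObj_of_notMem hβ hρ ξ hu, EReal.top_sub_coe]

theorem zero_mem_dualBall (hβ : 0 < β) (hρ : 0 < ρ) : (0 : E n) ∈ dualBall n β ρ := fun y => by
  rw [inner_zero_right]; exact reg_nonneg hβ hρ y

/-- The dual problem is solved by `(A x - b, -Aᵀ(A x - b))` for any primal solution `x`, and
its objective grows at least quadratically there. -/
theorem dualSolutions_eq (hβ : 0 < β) (hρ : 0 < ρ) {x : E n}
    (hx : x ∈ primalSolutions A b β ρ) : dualSolutions A b β ρ =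
      {WithLp.toLp 2 (A.toEuclideanLin x - b,
        -A.transpose.toEuclideanLin (A.toEuclideanLin x - b))} := by
  have hs := subgradAt_of_mem_primalSolutions hβ hρ hx
  set ξs := A.toEuclideanLin x - b with hξs
  set us := -A.transpose.toEuclideanLin ξs with hus
  have hus_mem : us ∈ dualBall n β ρ := hs.1
  have growth : ∀ (ξ : E m) (u : E n), dualResidual A ξ u = 0 → u ∈ dualBall n β ρ →
      1 / 2 * ‖ξs‖ ^ 2 + inner ℝ b ξs + 1 / 2 * ‖ξ - ξs‖ ^ 2 ≤
        1 / 2 * ‖ξ‖ ^ 2 + inner ℝ b ξ := by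
    intro ξ u h0 hu
    have h1 := half_sq_norm_add ξs (ξ - ξs)
    rw [add_sub_cancel] at h1
    have h2 : inner ℝ ξs (ξ - ξs) + inner ℝ b (ξ - ξs) =
        inner ℝ (A.toEuclideanLin x) (ξ - ξs) := by
      rw [← inner_add_left, hξs, sub_add_cancel]
    have h3 : A.transpose.toEuclideanLin (ξ - ξs) = us - u := by
      rw [map_sub, eq_neg_of_add_eq_zero_left h0, hus]; abel
    rw [inner_toEuclideanLin_left, h3, inner_sub_right x, hs.2] at h2
    rw [inner_sub_right b] at h2
    linarith [hu x]
  have hfeas : dualResidual A ξs us = 0 := by simp [dualResidual, hus]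
  ext q
  rw [Set.mem_singleton_iff]
  constructor
  · rintro ⟨h0, hmin⟩
    have hle := hmin ξs us hfeas
    rw [dualObj_of_mem hβ hρ ξs hus_mem] at hle
    have hmem : q.snd ∈ dualBall n β ρ := by
      by_contra hn
      rw [dualObj_of_notMem hβ hρ _ hn, top_le_iff] at hle
      exact EReal.coe_ne_top _ hle
    rw [dualObj_of_mem hβ hρ _ hmem, EReal.coe_le_coe_iff] at hle
    have h1 := growth _ _ h0 hmem
    have h2 : ‖q.fst - ξs‖ = 0 := by nlinarith [norm_nonneg (q.fst - ξs)]
    have h3 : q.fst = ξs := sub_eq_zero.1 (norm_eq_zero.1 h2)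
    have h4 : q.snd = us := by
      rw [eq_neg_of_add_eq_zero_right h0, h3]
    rw [← h3, ← h4]
    rfl
  · rintro rfl
    refine ⟨hfeas, fun ξ u h0 => ?_⟩
    change dualObj b β ρ ξs us ≤ _
    by_cases hu : u ∈ dualBall n β ρ
    · rw [dualObj_of_mem hβ hρ _ hu, dualObj_of_mem hβ hρ _ hus_mem, EReal.coe_le_coe_iff]
      have := growth ξ u h0 hu
      nlinarith [sq_nonneg ‖ξ - ξs‖]
    · rw [dualObj_of_notMem hβ hρ _ hu]
      exact le_top

theorem eq_of_forall_inner_le_half_sq {F : Type*} [NormedAddCommGroup F] [InnerProductSpace ℝ F]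
    {v w : F} (h : ∀ d, inner ℝ v d ≤ inner ℝ w d + 1 / 2 * ‖d‖ ^ 2) : v = w := by
  have h1 := h (v - w)
  have h2 := real_inner_self_eq_norm_sq (v - w)
  rw [inner_sub_left] at h2
  have : ‖v - w‖ = 0 := by nlinarith [norm_nonneg (v - w)]
  exact sub_eq_zero.1 (norm_eq_zero.1 this)

/-- Expansion of the smooth part of the Lagrangian. -/
theorem lagrangian_expand (A : Matrix (Fin m) (Fin n) ℝ) (b : E m) (ξ ζ : E m) (u v x : E n) :
    1 / 2 * ‖ζ‖ ^ 2 + inner ℝ b ζ - inner ℝ x (dualResidual A ζ v) =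
      1 / 2 * ‖ξ‖ ^ 2 + inner ℝ b ξ - inner ℝ x (dualResidual A ξ u) +
        inner ℝ (ξ + b - A.toEuclideanLin x) (ζ - ξ) - inner ℝ x (v - u) +
        1 / 2 * ‖ζ - ξ‖ ^ 2 := by
  have h1 := half_sq_norm_add ξ (ζ - ξ)
  rw [add_sub_cancel] at h1
  rw [h1, inner_sub_left, inner_add_left, inner_toEuclideanLin_left, map_sub]
  simp only [dualResidual, inner_add_right, inner_sub_right]
  ring

/-- The Karush-Kuhn-Tucker operator, componentwise. -/
theorem mem_opLagrangian_iff (hβ : 0 < β) (hρ : 0 < ρ) {ξ ξ' : E m} {u x u' x' : E n} :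
    WithLp.toLp 2 (WithLp.toLp 2 (ξ', u'), x') ∈
        opLagrangian A b β ρ (WithLp.toLp 2 (WithLp.toLp 2 (ξ, u), x)) ↔
      ξ' = ξ + b - A.toEuclideanLin x ∧ SubgradAt (reg β ρ) (x + u') u ∧
        x' = dualResidual A ξ u := by
  change ((∀ q : DualSpace m n, lagrangian A b β ρ ξ u x +
      ((inner ℝ (WithLp.toLp 2 (ξ', u') : DualSpace m n) (q - WithLp.toLp 2 (ξ, u)) : ℝ) :
        EReal) ≤ lagrangian A b β ρ q.fst q.snd x) ∧
    ∀ y, lagrangian A b β ρ ξ u y ≤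
      lagrangian A b β ρ ξ u x + ((inner ℝ (-x') (y - x) : ℝ) : EReal)) ↔ _
  constructor
  · rintro ⟨h1, h2⟩
    have hu : u ∈ dualBall n β ρ := by
      by_contra hn
      have h := h1 (WithLp.toLp 2 (0, 0))
      change _ ≤ lagrangian A b β ρ 0 0 x at h
      rw [lagrangian_of_notMem hβ hρ _ hn, EReal.top_add_coe,
        lagrangian_of_mem hβ hρ _ (zero_mem_dualBall hβ hρ), top_le_iff] at h
      exact EReal.coe_ne_top _ h
    have h1' : ∀ (ζ : E m) (v : E n), v ∈ dualBall n β ρ →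
        inner ℝ ξ' (ζ - ξ) + inner ℝ u' (v - u) ≤
          inner ℝ (ξ + b - A.toEuclideanLin x) (ζ - ξ) - inner ℝ x (v - u) +
            1 / 2 * ‖ζ - ξ‖ ^ 2 := by
      intro ζ v hv
      have h := h1 (WithLp.toLp 2 (ζ, v))
      change _ ≤ lagrangian A b β ρ ζ v x at h
      rw [lagrangian_of_mem hβ hρ _ hu, lagrangian_of_mem hβ hρ _ hv, ← EReal.coe_add,
        EReal.coe_le_coe_iff] at h
      have h3 := lagrangian_expand A b ξ ζ u v x
      rw [WithLp.prod_inner_apply] at h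
      change _ + (inner ℝ ξ' (ζ - ξ) + inner ℝ u' (v - u)) ≤ _ at h
      linarith
    refine ⟨?_, ⟨hu, ?_⟩, ?_⟩
    · refine eq_of_forall_inner_le_half_sq fun d => ?_
      have := h1' (ξ + d) u hu
      simpa using this
    · obtain ⟨v, hv⟩ := (isPolyhedralSublinear_reg hβ hρ).exists_subgradAt (x + u')
      refine le_antisymm (hu _) ?_
      have := h1' ξ v hv.1
      rw [← hv.2]
      simp only [sub_self, inner_zero_right, norm_zero, inner_sub_right, inner_add_left] at this ⊢
      linarith
    · refine eq_of_forall_inner_le_half_sq fun d => ?_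
      have h := h2 (x + d)
      rw [lagrangian_of_mem hβ hρ _ hu, lagrangian_of_mem hβ hρ _ hu, ← EReal.coe_add,
        EReal.coe_le_coe_iff] at h
      change _ - inner ℝ (x + d) (dualResidual A ξ u) ≤
        _ - inner ℝ x (dualResidual A ξ u) + inner ℝ (-x') (x + d - x) at h
      rw [add_sub_cancel_left, inner_neg_left, inner_add_left, real_inner_comm _ d] at h
      nlinarith [sq_nonneg ‖d‖]
  · rintro ⟨rfl, ⟨hu, hxu⟩, rfl⟩
    refine ⟨fun q => ?_, fun y => ?_⟩
    · by_cases hv : q.snd ∈ dualBall n β ρ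
      · rw [lagrangian_of_mem hβ hρ _ hu, lagrangian_of_mem hβ hρ _ hv, ← EReal.coe_add,
          EReal.coe_le_coe_iff, lagrangian_expand A b ξ q.fst u q.snd x, WithLp.prod_inner_apply]
        change _ + (inner ℝ (ξ + b - A.toEuclideanLin x) (q.fst - ξ) + inner ℝ u' (q.snd - u)) ≤ _
        have := hv (x + u')
        rw [← hxu, inner_add_left, inner_add_left] at this
        rw [inner_sub_right u', inner_sub_right x]
        nlinarith [sq_nonneg ‖q.fst - ξ‖]
      · rw [lagrangian_of_notMem hβ hρ _ hv]
        exact le_top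
    · rw [lagrangian_of_mem hβ hρ _ hu, lagrangian_of_mem hβ hρ _ hu, ← EReal.coe_add,
        EReal.coe_le_coe_iff]
      rw [inner_neg_left, inner_sub_right, real_inner_comm x, real_inner_comm y]
      linarith

theorem norm_fst_le {F G : Type*} [NormedAddCommGroup F] [NormedAddCommGroup G]
    (z : WithLp 2 (F × G)) : ‖z.fst‖ ≤ ‖z‖ :=
  le_of_sq_le_sq (by rw [WithLp.prod_norm_sq_eq_of_L2]; nlinarith [sq_nonneg ‖z.snd‖])
    (norm_nonneg z)

theorem norm_snd_le {F G : Type*} [NormedAddCommGroup F] [NormedAddCommGroup G]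
    (z : WithLp 2 (F × G)) : ‖z.snd‖ ≤ ‖z‖ :=
  le_of_sq_le_sq (by rw [WithLp.prod_norm_sq_eq_of_L2]; nlinarith [sq_nonneg ‖z.fst‖])
    (norm_nonneg z)

theorem norm_le_norm_fst_add_norm_snd {F G : Type*} [NormedAddCommGroup F]
    [NormedAddCommGroup G] (z : WithLp 2 (F × G)) : ‖z‖ ≤ ‖z.fst‖ + ‖z.snd‖ := by
  refine le_of_sq_le_sq ?_ (by positivity)
  rw [WithLp.prod_norm_sq_eq_of_L2]
  nlinarith [mul_nonneg (norm_nonneg z.fst) (norm_nonneg z.snd)]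

/-- The set of Karush-Kuhn-Tucker points. -/
abbrev saddlePoints (A : Matrix (Fin m) (Fin n) ℝ) (b : E m) (β ρ : ℝ) :
    Set (TripleSpace m n) :=
  {z | z.fst ∈ dualSolutions A b β ρ ∧ z.snd ∈ primalSolutions A b β ρ}

theorem toLp_mem_saddlePoints (hβ : 0 < β) (hρ : 0 < ρ) {x : E n}
    (hx : x ∈ primalSolutions A b β ρ) :
    WithLp.toLp 2 (WithLp.toLp 2 (A.toEuclideanLin x - b,
      -A.transpose.toEuclideanLin (A.toEuclideanLin x - b)), x) ∈ saddlePoints A b β ρ :=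
  ⟨by rw [dualSolutions_eq hβ hρ hx]; rfl, hx⟩

theorem saddlePoints_nonempty (A : Matrix (Fin m) (Fin n) ℝ) (b : E m) (hβ : 0 < β)
    (hρ : 0 < ρ) : (saddlePoints A b β ρ).Nonempty := by
  obtain ⟨x, hx⟩ := primalSolutions_nonempty A b hβ hρ
  exact ⟨_, toLp_mem_saddlePoints hβ hρ hx⟩

theorem exists_isLagrangianModulus (A : Matrix (Fin m) (Fin n) ℝ) (b : E m) (hβ : 0 < β)
    (hρ : 0 < ρ) : ∃ a, IsLagrangianModulus A b β ρ a := by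
  obtain ⟨a, ha, hf⟩ := exists_infDist_le_of_mem_opPrimal A b hβ hρ
  obtain ⟨C, hC0, hC⟩ := exists_norm_toEuclideanLin_le A
  obtain ⟨D, hD0, hD⟩ := exists_norm_toEuclideanLin_le A.transpose
  set K := 1 + D + D * C with hK
  have hK0 : 0 < K := by positivity
  set R := a * K + 1 with hR
  have hR0 : 0 < R := by positivity
  refine ⟨1 + C * R + (1 + D * (1 + C * R)) + R,
    isErrorBoundModulus_of_forall_mem (ε := β / 2 / K) (by positivity) (by positivity)
      (saddlePoints_nonempty A b hβ hρ) ?_⟩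
  rintro ⟨⟨⟨ξ, u⟩⟩, x⟩ w hw hwε
  obtain ⟨⟨⟨ξ', u'⟩⟩, x'⟩ := w
  set w : TripleSpace m n := WithLp.toLp 2 (WithLp.toLp 2 (ξ', u'), x') with hwdef
  have hξ'w : ‖ξ'‖ ≤ ‖w‖ := (norm_fst_le w.fst).trans (norm_fst_le w)
  have hu'w : ‖u'‖ ≤ ‖w‖ := (norm_snd_le w.fst).trans (norm_fst_le w)
  have hx'w : ‖x'‖ ≤ ‖w‖ := norm_snd_le w
  obtain ⟨h1, h2, h3⟩ := (mem_opLagrangian_iff hβ hρ).1 hw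
  have hξ : ξ = A.toEuclideanLin x - b + ξ' := by rw [h1]; abel
  have hu : u = x' - A.transpose.toEuclideanLin ξ := by rw [h3, dualResidual]; abel
  set v := x' - A.transpose.toEuclideanLin ξ' +
    A.transpose.toEuclideanLin (A.toEuclideanLin u') with hv
  have hvmem : v ∈ opPrimal A b β ρ (x + u') := by
    have := h2.mem_opPrimal (A := A) (b := b)
    convert this using 1
    rw [hv, hu, hξ]
    simp only [map_add, map_sub]
    abel
  have hvw : ‖v‖ ≤ K * ‖w‖ := by
    have h4 := norm_add_le (x' - A.transpose.toEuclideanLin ξ')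
      (A.transpose.toEuclideanLin (A.toEuclideanLin u'))
    have h5 := norm_sub_le x' (A.transpose.toEuclideanLin ξ')
    have h6 : ‖A.transpose.toEuclideanLin ξ'‖ ≤ D * ‖w‖ :=
      (hD _).trans (mul_le_mul_of_nonneg_left hξ'w hD0)
    have h7 : ‖A.transpose.toEuclideanLin (A.toEuclideanLin u')‖ ≤ D * (C * ‖w‖) :=
      (hD _).trans (mul_le_mul_of_nonneg_left
        ((hC _).trans (mul_le_mul_of_nonneg_left hu'w hC0)) hD0)
    rw [hK]
    linarith
  have hvε : ‖v‖ ≤ β / 2 := by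
    refine hvw.trans ?_
    rw [← le_div_iff₀' hK0]
    exact hwε
  have hy := hf _ v hvmem hvε
  obtain ⟨z, hz, hyz⟩ := exists_mem_primalSolutions_norm_sub_eq A b hβ hρ (x + u')
  rw [hyz] at hy
  have hxz : ‖x - z‖ ≤ R * ‖w‖ := by
    have h4 := norm_sub_le (x + u' - z) u'
    have h5 : x + u' - z - u' = x - z := by abel
    rw [h5] at h4
    have := mul_le_mul_of_nonneg_left hvw ha.le
    rw [hR]
    linarith
  have hξz : ‖ξ - (A.toEuclideanLin z - b)‖ ≤ (1 + C * R) * ‖w‖ := by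
    have e : ξ - (A.toEuclideanLin z - b) = ξ' + A.toEuclideanLin (x - z) := by
      rw [hξ, map_sub]; abel
    rw [e]
    have h4 := norm_add_le ξ' (A.toEuclideanLin (x - z))
    have h5 := (hC (x - z)).trans (mul_le_mul_of_nonneg_left hxz hC0)
    linarith
  have huz : ‖u - -A.transpose.toEuclideanLin (A.toEuclideanLin z - b)‖ ≤
      (1 + D * (1 + C * R)) * ‖w‖ := by
    have e : u - -A.transpose.toEuclideanLin (A.toEuclideanLin z - b) =
        x' - A.transpose.toEuclideanLin (ξ - (A.toEuclideanLin z - b)) := by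
      rw [hu, map_sub _ ξ]; abel
    rw [e]
    have h4 := norm_sub_le x' (A.transpose.toEuclideanLin (ξ - (A.toEuclideanLin z - b)))
    have h5 := (hD (ξ - (A.toEuclideanLin z - b))).trans (mul_le_mul_of_nonneg_left hξz hD0)
    linarith
  refine (Metric.infDist_le_dist_of_mem (toLp_mem_saddlePoints hβ hρ hz)).trans ?_
  rw [dist_eq_norm]
  refine (norm_le_norm_fst_add_norm_snd _).trans ?_
  refine (add_le_add (norm_le_norm_fst_add_norm_snd _) le_rfl).trans ?_
  change ‖ξ - (A.toEuclideanLin z - b)‖ +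
    ‖u - -A.transpose.toEuclideanLin (A.toEuclideanLin z - b)‖ + ‖x - z‖ ≤ _
  linarith

end Dual

section Prox

variable {m n : ℕ} {β ρ : ℝ}

theorem subgradAt_prox (hβ : 0 < β) (hρ : 0 < ρ) (y : E n) :
    SubgradAt (reg β ρ) (prox (reg β ρ) y) (y - prox (reg β ρ) y) := by
  have h := (isPolyhedralSublinear_reg hβ hρ).subgradAt_of_isMin
    (g := fun x => 1 / 2 * ‖x - y‖ ^ 2) (z := prox (reg β ρ) y) (v := prox (reg β ρ) y - y)
    (C := 1 / 2) (fun x => ?_) (isProx_prox hβ hρ y)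
  · rwa [neg_sub] at h
  · rw [← half_sq_norm_add]
    apply le_of_eq
    congr 3
    abel

/-- `y - prox y` is the point of the dual ball closest to `y`. -/
theorem sq_norm_prox_le (hβ : 0 < β) (hρ : 0 < ρ) (y : E n) {u : E n}
    (hu : u ∈ dualBall n β ρ) : ‖prox (reg β ρ) y‖ ^ 2 ≤ ‖y - u‖ ^ 2 := by
  have h := subgradAt_prox hβ hρ y
  set z := prox (reg β ρ) y
  have h1 := half_sq_norm_add z (y - z - u)
  have e : z + (y - z - u) = y - u := by abel
  have h2 := hu z
  have h3 := h.2
  rw [e, inner_sub_right] at h1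
  nlinarith [sq_nonneg ‖y - z - u‖]

/-- The function `½‖prox y‖²`, half the squared distance to the dual ball, is differentiable
with gradient `prox y`, and its second-order variation is at most that of `½‖y‖²`. -/
theorem half_sq_norm_prox_expand (hβ : 0 < β) (hρ : 0 < ρ) (y d : E n) :
    0 ≤ 1 / 2 * ‖prox (reg β ρ) (y + d)‖ ^ 2 - 1 / 2 * ‖prox (reg β ρ) y‖ ^ 2 -
        inner ℝ (prox (reg β ρ) y) d ∧
      1 / 2 * ‖prox (reg β ρ) (y + d)‖ ^ 2 - 1 / 2 * ‖prox (reg β ρ) y‖ ^ 2 -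
        inner ℝ (prox (reg β ρ) y) d ≤ 1 / 2 * ‖d‖ ^ 2 := by
  have hy := subgradAt_prox hβ hρ y
  have hd := subgradAt_prox hβ hρ (y + d)
  have hle := sq_norm_prox_le hβ hρ (y + d) hy.1
  set z := prox (reg β ρ) y
  set z' := prox (reg β ρ) (y + d)
  constructor
  · have h1 := half_sq_norm_add z (z' - z)
    rw [add_sub_cancel] at h1
    have h2 := hd.1 z
    rw [← hy.2] at h2
    simp only [inner_sub_right, inner_add_right] at h1 h2
    nlinarith [sq_nonneg ‖z' - z‖]
  · have e : y + d - (y - z) = z + d := by abel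
    rw [e] at hle
    have h1 := half_sq_norm_add z d
    linarith

end Prox

section Subproblem

variable {m n : ℕ} {A : Matrix (Fin m) (Fin n) ℝ} {b : E m} {β ρ : ℝ}

theorem augLagrangian_of_mem (hβ : 0 < β) (hρ : 0 < ρ) {σ : ℝ} (hσ : 0 < σ) (x : E n) (ξ : E m)
    {u : E n} (hu : u ∈ dualBall n β ρ) : augLagrangian A b β ρ σ ξ u x =
      ((1 / 2 * ‖ξ‖ ^ 2 + inner ℝ b ξ +
        σ / 2 * ‖σ⁻¹ • x - A.transpose.toEuclideanLin ξ - u‖ ^ 2 - σ⁻¹ / 2 * ‖x‖ ^ 2 : ℝ) :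
        EReal) := by
  rw [augLagrangian, lagrangian_of_mem hβ hρ _ hu, ← EReal.coe_add, EReal.coe_eq_coe_iff]
  have e : σ⁻¹ • x - A.transpose.toEuclideanLin ξ - u = σ⁻¹ • x - dualResidual A ξ u := by
    rw [dualResidual]; abel
  rw [e, norm_sub_sq_real, real_inner_smul_left, norm_smul, Real.norm_eq_abs, mul_pow, sq_abs]
  field_simp
  ring

theorem augLagrangian_of_notMem (hβ : 0 < β) (hρ : 0 < ρ) (σ : ℝ) (x : E n) (ξ : E m)
    {u : E n} (hu : u ∉ dualBall n β ρ) : augLagrangian A b β ρ σ ξ u x = ⊤ := by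
  rw [augLagrangian, lagrangian_of_notMem hβ hρ _ hu, EReal.top_add_coe]

theorem subproblemFun_eq (hβ : 0 < β) (hρ : 0 < ρ) {σ : ℝ} (hσ : 0 < σ) (x : E n) (ξ : E m) :
    subproblemFun A b β ρ σ x ξ = 1 / 2 * ‖ξ‖ ^ 2 + inner ℝ b ξ +
      σ / 2 * ‖prox (reg β ρ) (σ⁻¹ • x - A.transpose.toEuclideanLin ξ)‖ ^ 2 -
      σ⁻¹ / 2 * ‖x‖ ^ 2 := by
  set y := σ⁻¹ • x - A.transpose.toEuclideanLin ξ with hy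
  have h : ⨅ u : E n, augLagrangian A b β ρ σ ξ u x =
      ((1 / 2 * ‖ξ‖ ^ 2 + inner ℝ b ξ + σ / 2 * ‖prox (reg β ρ) y‖ ^ 2 -
        σ⁻¹ / 2 * ‖x‖ ^ 2 : ℝ) : EReal) := by
    apply le_antisymm
    · refine (iInf_le _ (y - prox (reg β ρ) y)).trans ?_
      rw [augLagrangian_of_mem hβ hρ hσ x ξ (subgradAt_prox hβ hρ y).1, ← hy, sub_sub_cancel]
    · refine le_iInf fun u => ?_
      by_cases hu : u ∈ dualBall n β ρ
      · rw [augLagrangian_of_mem hβ hρ hσ x ξ hu, EReal.coe_le_coe_iff]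
        have := mul_le_mul_of_nonneg_left (sq_norm_prox_le hβ hρ y hu) (half_pos hσ).le
        linarith
      · rw [augLagrangian_of_notMem hβ hρ σ x ξ hu]
        exact le_top
  rw [subproblemFun, h, EReal.toReal_coe]

theorem hasGradientAt_of_abs_le {F : Type*} [NormedAddCommGroup F] [InnerProductSpace ℝ F]
    [CompleteSpace F] {f : F → ℝ} {x v : F} {C : ℝ}
    (h : ∀ y, |f y - f x - inner ℝ v (y - x)| ≤ C * ‖y - x‖ ^ 2) : HasGradientAt f v x := by
  rw [hasGradientAt_iff_isLittleO]
  refine Asymptotics.IsBigO.trans_isLittleO (g := fun y => ‖y - x‖ ^ 2) ?_ ?_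
  · refine Asymptotics.IsBigO.of_bound C (Eventually.of_forall fun y => ?_)
    rw [Real.norm_eq_abs, Real.norm_eq_abs, abs_of_nonneg (sq_nonneg ‖y - x‖)]
    exact h y
  · exact Asymptotics.isLittleO_norm_pow_id one_lt_two |>.comp_tendsto
      (k := fun y => y - x) (by
        have : Continuous fun y : F => y - x := by fun_prop
        simpa using this.tendsto x)

theorem hasGradientAt_subproblemFun (hβ : 0 < β) (hρ : 0 < ρ) {σ : ℝ} (hσ : 0 < σ) (x : E n)
    (ξ : E m) : HasGradientAt (subproblemFun A b β ρ σ x)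
      (ξ + b - A.toEuclideanLin
        (σ • prox (reg β ρ) (σ⁻¹ • x - A.transpose.toEuclideanLin ξ))) ξ := by
  obtain ⟨C, hC0, hC⟩ := exists_norm_toEuclideanLin_le A.transpose
  refine hasGradientAt_of_abs_le (C := 1 / 2 + σ / 2 * C ^ 2) fun ζ => ?_
  rw [subproblemFun_eq hβ hρ hσ, subproblemFun_eq hβ hρ hσ]
  have hζ : σ⁻¹ • x - A.transpose.toEuclideanLin ζ =
      σ⁻¹ • x - A.transpose.toEuclideanLin ξ + -A.transpose.toEuclideanLin (ζ - ξ) := by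
    rw [map_sub]; abel
  obtain ⟨h1, h2⟩ := half_sq_norm_prox_expand hβ hρ
    (σ⁻¹ • x - A.transpose.toEuclideanLin ξ) (-A.transpose.toEuclideanLin (ζ - ξ))
  rw [← hζ] at h1 h2
  set z := prox (reg β ρ) (σ⁻¹ • x - A.transpose.toEuclideanLin ξ)
  set z' := prox (reg β ρ) (σ⁻¹ • x - A.transpose.toEuclideanLin ζ)
  have h3 := half_sq_norm_add ξ (ζ - ξ)
  rw [add_sub_cancel] at h3
  rw [norm_neg] at h2
  have h4 : ‖A.transpose.toEuclideanLin (ζ - ξ)‖ ^ 2 ≤ C ^ 2 * ‖ζ - ξ‖ ^ 2 := by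
    rw [← mul_pow]; exact pow_le_pow_left₀ (norm_nonneg _) (hC _) 2
  have h5 : inner ℝ (ξ + b - A.toEuclideanLin (σ • z)) (ζ - ξ) =
      inner ℝ ξ (ζ - ξ) + (inner ℝ b ζ - inner ℝ b ξ) +
        σ * inner ℝ z (-A.transpose.toEuclideanLin (ζ - ξ)) := by
    rw [inner_sub_left, inner_add_left, inner_sub_right b, map_smul, real_inner_smul_left,
      inner_toEuclideanLin_left, inner_neg_right]
    ring
  have h6 := mul_nonneg hσ.le h1
  have h7 := mul_le_mul_of_nonneg_left (h2.trans (mul_le_mul_of_nonneg_left h4 one_half_pos.le))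
    hσ.le
  rw [h5, abs_le]
  constructor
  · have : 0 ≤ (1 / 2 + σ / 2 * C ^ 2) * ‖ζ - ξ‖ ^ 2 := by positivity
    nlinarith [sq_nonneg ‖ζ - ξ‖]
  · nlinarith

end Subproblem

section ProximalPoint

variable {m n : ℕ} {A : Matrix (Fin m) (Fin n) ℝ} {b : E m} {β ρ : ℝ}

/-- An inexact multiplier step stays close to the exact proximal step. -/
theorem exists_exact_step (A : Matrix (Fin m) (Fin n) ℝ) (b : E m) (hβ : 0 < β) (hρ : 0 < ρ)
    {σ : ℝ} (hσ : 0 < σ) (x : E n) : ∃ z, σ⁻¹ • (x - z) ∈ opPrimal A b β ρ z ∧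
      ∀ (ξ : E m) (u x' : E n), x' = x - σ • dualResidual A ξ u → SubgradAt (reg β ρ) x' u →
        ‖x' - z‖ ≤ √σ * ‖ξ + b - A.toEuclideanLin x'‖ := by
  obtain ⟨z, w, hw, hz⟩ := exists_proximal_step A b hβ hρ (inv_pos.2 hσ).le x
  refine ⟨z, hz ▸ hw.mem_opPrimal, fun ξ u x' hx' hu => ?_⟩
  set r := ξ + b - A.toEuclideanLin x' with hr
  have h1 : x - z = σ • (A.transpose.toEuclideanLin (A.toEuclideanLin z - b) + w) := by
    rw [← hz, smul_inv_smul₀ hσ.ne']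
  have hξ : ξ = A.toEuclideanLin x' - b + r := by rw [hr]; abel
  have h2 : x' - z = σ • -(A.transpose.toEuclideanLin (A.toEuclideanLin (x' - z) + r) +
      (u - w)) := by
    have h3 : x - x' = σ • dualResidual A ξ u := by rw [hx']; abel
    calc x' - z = (x - z) - (x - x') := by abel
      _ = _ := by
        rw [h1, h3, ← smul_sub, dualResidual, hξ]
        congr 1
        simp only [map_add, map_sub]
        abel
  have h4 : ‖x' - z‖ ^ 2 = -σ * (‖A.toEuclideanLin (x' - z)‖ ^ 2 +
      inner ℝ (A.toEuclideanLin (x' - z)) r + inner ℝ (u - w) (x' - z)) := by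
    conv_lhs => rw [← real_inner_self_eq_norm_sq]
    conv_lhs => arg 3; rw [h2]
    rw [real_inner_smul_right, inner_neg_right, inner_add_right, ← inner_toEuclideanLin_left,
      inner_add_right, real_inner_self_eq_norm_sq, real_inner_comm (u - w)]
    ring
  have h5 := hu.monotone hw
  have h6 := abs_le.1 (abs_real_inner_le_norm (A.toEuclideanLin (x' - z)) r)
  refine le_of_sq_le_sq ?_ (by positivity)
  rw [mul_pow, Real.sq_sqrt hσ.le, h4]
  have h7 : -(‖A.toEuclideanLin (x' - z)‖ ^ 2 + inner ℝ (A.toEuclideanLin (x' - z)) r +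
      inner ℝ (u - w) (x' - z)) ≤ ‖r‖ ^ 2 := by
    nlinarith [sq_nonneg (‖A.toEuclideanLin (x' - z)‖ - ‖r‖), sq_nonneg ‖r‖,
      sq_nonneg ‖A.toEuclideanLin (x' - z)‖]
  calc _ = σ * -(‖A.toEuclideanLin (x' - z)‖ ^ 2 + inner ℝ (A.toEuclideanLin (x' - z)) r +
      inner ℝ (u - w) (x' - z)) := by ring
    _ ≤ _ := mul_le_mul_of_nonneg_left h7 hσ.le

/-- The exact proximal step is Fejér monotone with respect to the solution set. -/
theorem exact_step_fejer {σ : ℝ} (hσ : 0 < σ) {x z y : E n}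
    (hz : σ⁻¹ • (x - z) ∈ opPrimal A b β ρ z) (hy : y ∈ primalSolutions A b β ρ) :
    ‖z - y‖ ^ 2 + ‖x - z‖ ^ 2 ≤ ‖x - y‖ ^ 2 := by
  rw [mem_opPrimal_iff] at hz
  have h1 := hz y
  have h2 := hy z
  rw [real_inner_smul_left] at h1
  have h3 : σ⁻¹ * inner ℝ (x - z) (y - z) ≤ 0 := by linarith
  have h4 := nonpos_of_mul_nonpos_right h3 (inv_pos.2 hσ)
  have e : x - y = (x - z) - (y - z) := by abel
  rw [e, norm_sub_sq_real (x - z), norm_sub_rev z y]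
  linarith

end ProximalPoint

section QuasiFejer

/-- A nonnegative real sequence that increases by summable amounts converges. -/
theorem exists_tendsto_of_le_add_summable {a e : ℕ → ℝ} (ha : ∀ k, 0 ≤ a k) (he0 : ∀ k, 0 ≤ e k)
    (he : Summable e) (h : ∀ k, a (k + 1) ≤ a k + e k) : ∃ l, Tendsto a atTop (𝓝 l) := by
  set c : ℕ → ℝ := fun k => a k - ∑ i ∈ Finset.range k, e i
  have hanti : Antitone c := antitone_nat_of_succ_le fun k => by
    simp only [c, Finset.sum_range_succ]
    linarith [h k]
  have hbdd : BddBelow (Set.range c) := by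
    refine ⟨-∑' i, e i, ?_⟩
    rintro _ ⟨k, rfl⟩
    have := he.sum_le_tsum (Finset.range k) fun i _ => he0 i
    simp only [c]
    linarith [ha k]
  have := (tendsto_atTop_ciInf hanti hbdd).add he.hasSum.tendsto_sum_nat
  exact ⟨_, this.congr fun k => by simp [c]⟩

variable {F : Type*} [NormedAddCommGroup F] {S : Set F} {x z : ℕ → F} {e : ℕ → ℝ}

theorem exists_tendsto_norm_sub (he0 : ∀ k, 0 ≤ e k) (he : Summable e)
    (hz : ∀ k, ∀ y ∈ S, ‖z k - y‖ ^ 2 + ‖x k - z k‖ ^ 2 ≤ ‖x k - y‖ ^ 2)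
    (hx : ∀ k, ‖x (k + 1) - z k‖ ≤ e k) {y : F} (hy : y ∈ S) :
    ∃ l, Tendsto (fun k => ‖x k - y‖) atTop (𝓝 l) := by
  refine exists_tendsto_of_le_add_summable (fun _ => norm_nonneg _) he0 he fun k => ?_
  have h1 : ‖z k - y‖ ≤ ‖x k - y‖ :=
    le_of_sq_le_sq (by nlinarith [hz k y hy, sq_nonneg ‖x k - z k‖]) (norm_nonneg _)
  have h2 := norm_sub_le_norm_sub_add_norm_sub (x (k + 1)) (z k) y
  linarith [hx k]

theorem tendsto_norm_sub_exact_step (he0 : ∀ k, 0 ≤ e k) (he : Summable e)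
    (hz : ∀ k, ∀ y ∈ S, ‖z k - y‖ ^ 2 + ‖x k - z k‖ ^ 2 ≤ ‖x k - y‖ ^ 2)
    (hx : ∀ k, ‖x (k + 1) - z k‖ ≤ e k) (hS : S.Nonempty) :
    Tendsto (fun k => ‖x k - z k‖) atTop (𝓝 0) := by
  obtain ⟨y, hy⟩ := hS
  obtain ⟨l, hl⟩ := exists_tendsto_norm_sub he0 he hz hx hy
  have hl1 : Tendsto (fun k => ‖x (k + 1) - y‖ - e k) atTop (𝓝 (l - 0)) :=
    (hl.comp (tendsto_add_atTop_nat 1)).sub he.tendsto_atTop_zero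
  rw [sub_zero] at hl1
  have hzl : Tendsto (fun k => ‖z k - y‖) atTop (𝓝 l) := by
    refine tendsto_of_tendsto_of_tendsto_of_le_of_le hl1 hl (fun k => ?_) fun k => ?_
    · have h2 := norm_sub_le_norm_sub_add_norm_sub (x (k + 1)) (z k) y
      have := hx k
      simp only
      linarith
    · exact le_of_sq_le_sq (by nlinarith [hz k y hy, sq_nonneg ‖x k - z k‖]) (norm_nonneg _)
  have hsq : Tendsto (fun k => √(‖x k - y‖ ^ 2 - ‖z k - y‖ ^ 2)) atTop (𝓝 0) := by
    have := ((hl.pow 2).sub (hzl.pow 2)).sqrt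
    rwa [sub_self, Real.sqrt_zero] at this
  refine squeeze_zero (fun k => norm_nonneg _) (fun k => ?_) hsq
  exact Real.le_sqrt_of_sq_le (by linarith [hz k y hy])

theorem exists_tendsto_of_quasiFejer [ProperSpace F] (he0 : ∀ k, 0 ≤ e k) (he : Summable e)
    (hz : ∀ k, ∀ y ∈ S, ‖z k - y‖ ^ 2 + ‖x k - z k‖ ^ 2 ≤ ‖x k - y‖ ^ 2)
    (hx : ∀ k, ‖x (k + 1) - z k‖ ≤ e k) (hSc : IsClosed S) (hS : S.Nonempty)
    (hzS : Tendsto (fun k => Metric.infDist (z k) S) atTop (𝓝 0)) :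
    ∃ y ∈ S, Tendsto x atTop (𝓝 y) := by
  have hxz := tendsto_norm_sub_exact_step he0 he hz hx hS
  have hxS : Tendsto (fun k => Metric.infDist (x k) S) atTop (𝓝 0) := by
    refine squeeze_zero (fun k => Metric.infDist_nonneg) (fun k => ?_)
      (by simpa using hzS.add hxz)
    rw [← dist_eq_norm]
    exact Metric.infDist_le_infDist_add_dist
  obtain ⟨y₀, hy₀⟩ := hS
  obtain ⟨l₀, hl₀⟩ := exists_tendsto_norm_sub he0 he hz hx hy₀
  obtain ⟨R, hR⟩ := hl₀.bddAbove_range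
  have hball : ∀ k, x k ∈ Metric.closedBall y₀ R := fun k => by
    rw [Metric.mem_closedBall, dist_eq_norm]
    exact hR ⟨k, rfl⟩
  obtain ⟨y, -, φ, hφ, hy⟩ := (isCompact_closedBall y₀ R).tendsto_subseq hball
  have hyS : y ∈ S := by
    rw [hSc.mem_iff_infDist_zero ⟨y₀, hy₀⟩]
    exact tendsto_nhds_unique
      ((Metric.continuous_infDist_pt S).continuousAt.tendsto.comp hy)
      (hxS.comp hφ.tendsto_atTop)
  obtain ⟨l, hl⟩ := exists_tendsto_norm_sub he0 he hz hx hyS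
  have hl0 : l = 0 := tendsto_nhds_unique (hl.comp hφ.tendsto_atTop)
    (tendsto_iff_norm_sub_tendsto_zero.1 hy)
  exact ⟨y, hyS, tendsto_iff_norm_sub_tendsto_zero.2 (hl0 ▸ hl)⟩

end QuasiFejer

section Rates

variable {σ : ℕ → ℝ} {σInf : ℝ≥0∞}

theorem tendsto_atTop_of_tendsto_ofReal_top
    (h : Tendsto (fun k => ENNReal.ofReal (σ k)) atTop (𝓝 ⊤)) : Tendsto σ atTop atTop := by
  refine tendsto_atTop.2 fun r => ?_
  filter_upwards [h.eventually (lt_mem_nhds (ENNReal.ofReal_lt_top (r := r)))] with k hk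
  exact (ENNReal.ofReal_lt_ofReal_iff'.1 hk).1.le

theorem tendsto_toReal_of_tendsto_ofReal (hσ : ∀ k, 0 ≤ σ k) (hInf : σInf ≠ ⊤)
    (h : Tendsto (fun k => ENNReal.ofReal (σ k)) atTop (𝓝 σInf)) :
    Tendsto σ atTop (𝓝 σInf.toReal) :=
  ((ENNReal.tendsto_toReal hInf).comp h).congr fun k => ENNReal.toReal_ofReal (hσ k)

theorem tendsto_primalRate (a : ℝ) {δ : ℕ → ℝ} (hσ : ∀ k, 0 ≤ σ k) (hInf0 : σInf ≠ 0)
    (h : Tendsto (fun k => ENNReal.ofReal (σ k)) atTop (𝓝 σInf))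
    (hδ : Tendsto δ atTop (𝓝 0)) :
    Tendsto (fun k => primalRate a (σ k) (δ k)) atTop (𝓝 (primalRateLimit a σInf)) := by
  have key : Tendsto (fun k => a / √(a ^ 2 + σ k ^ 2)) atTop (𝓝 (primalRateLimit a σInf)) := by
    unfold primalRateLimit
    split_ifs with hI
    · subst hI
      have h1 := tendsto_atTop_of_tendsto_ofReal_top h
      have h2 : Tendsto (fun k => √(a ^ 2 + σ k ^ 2)) atTop atTop :=
        tendsto_atTop_mono (fun k => Real.le_sqrt_of_sq_le (by nlinarith [sq_nonneg a])) h1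
      exact h2.const_div_atTop a
    · have h1 := tendsto_toReal_of_tendsto_ofReal hσ hI h
      have hpos := ENNReal.toReal_pos hInf0 hI
      exact tendsto_const_nhds.div ((h1.pow 2).const_add _).sqrt (by positivity)
  have h2 := (key.add (hδ.const_mul 2)).mul
    ((hδ.const_sub 1).inv₀ (by norm_num))
  simpa [primalRate] using h2

theorem primalRateLimit_lt_one {a : ℝ} (ha : 0 < a) (hInf0 : σInf ≠ 0) :
    primalRateLimit a σInf < 1 := by
  unfold primalRateLimit
  split_ifs with hI
  · exact zero_lt_one
  · have hpos := ENNReal.toReal_pos hInf0 hI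
    rw [div_lt_one (by positivity)]
    exact Real.lt_sqrt_of_sq_lt (by nlinarith)

theorem tendsto_dualRate (a : ℝ) {δ : ℕ → ℝ} (hσ : ∀ k, 0 ≤ σ k) (hInf0 : σInf ≠ 0)
    (h : Tendsto (fun k => ENNReal.ofReal (σ k)) atTop (𝓝 σInf))
    (hδ : Tendsto δ atTop (𝓝 0)) :
    Tendsto (fun k => dualRate a (σ k) (δ k)) atTop (𝓝 (dualRateLimit a σInf)) := by
  have h1 : Tendsto (fun k => a * (1 + δ k)) atTop (𝓝 a) := by
    simpa using (hδ.const_add 1).const_mul a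
  unfold dualRateLimit
  split_ifs with hI
  · subst hI
    exact h1.div_atTop (tendsto_atTop_of_tendsto_ofReal_top h)
  · exact h1.div (tendsto_toReal_of_tendsto_ofReal hσ hI h) (ENNReal.toReal_pos hInf0 hI).ne'

end Rates

section Algorithm

variable {m n : ℕ} {A : Matrix (Fin m) (Fin n) ℝ} {b : E m} {β ρ : ℝ}
  {σ : ℕ → ℝ} {σInf : ℝ≥0∞} {ξ : ℕ → E m} {u x : ℕ → E n} {ε : ℕ → ℝ}

namespace IsSsnalSequence

theorem sigma_pos' (h : IsSsnalSequence A β ρ σ σInf ξ u x) (k : ℕ) : 0 < σ k :=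
  h.sigma_pos.trans_le (h.sigma_mono (Nat.zero_le k))

theorem sigmaInf_ne_zero (h : IsSsnalSequence A β ρ σ σInf ξ u x) : σInf ≠ 0 := by
  have h1 : ENNReal.ofReal (σ 0) ≤ σInf := ge_of_tendsto h.sigma_tendsto
    (Eventually.of_forall fun k => ENNReal.ofReal_le_ofReal (h.sigma_mono (Nat.zero_le k)))
  exact ((ENNReal.ofReal_pos.2 h.sigma_pos).trans_le h1).ne'

theorem x_succ_eq (h : IsSsnalSequence A β ρ σ σInf ξ u x) (k : ℕ) : x (k + 1) =
    σ k • prox (reg β ρ) ((σ k)⁻¹ • x k - A.transpose.toEuclideanLin (ξ (k + 1))) := by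
  have e : x k = σ k • (σ k)⁻¹ • x k := (smul_inv_smul₀ (h.sigma_pos' k).ne' _).symm
  rw [h.x_step k]
  conv_lhs => rw [e]
  rw [← smul_sub, dualResidual, h.u_step k]
  congr 1
  abel

theorem subgradAt (hβ : 0 < β) (hρ : 0 < ρ) (h : IsSsnalSequence A β ρ σ σInf ξ u x) (k : ℕ) :
    SubgradAt (reg β ρ) (x (k + 1)) (u (k + 1)) := by
  rw [h.x_succ_eq k, h.u_step k]
  exact (isPolyhedralSublinear_reg hβ hρ).subgradAt_smul (subgradAt_prox hβ hρ _)
    (h.sigma_pos' k).le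

theorem subproblemResidual_eq (b : E m) (hβ : 0 < β) (hρ : 0 < ρ)
    (h : IsSsnalSequence A β ρ σ σInf ξ u x) (k : ℕ) :
    subproblemResidual A b β ρ σ ξ x k = ‖ξ (k + 1) + b - A.toEuclideanLin (x (k + 1))‖ := by
  rw [subproblemResidual, (hasGradientAt_subproblemFun hβ hρ (h.sigma_pos' k) _ _).gradient,
    ← h.x_succ_eq k]

theorem norm_x_sub (h : IsSsnalSequence A β ρ σ σInf ξ u x) (k : ℕ) :
    ‖x (k + 1) - x k‖ = σ k * ‖dualResidual A (ξ (k + 1)) (u (k + 1))‖ := by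
  rw [h.x_step k, sub_sub_cancel_left, norm_neg, norm_smul, Real.norm_eq_abs,
    abs_of_pos (h.sigma_pos' k)]

/-- The exact proximal steps that accompany the sequence. -/
theorem exists_exact_steps (b : E m) (hβ : 0 < β) (hρ : 0 < ρ)
    (h : IsSsnalSequence A β ρ σ σInf ξ u x) : ∃ z : ℕ → E n, ∀ k,
      (σ k)⁻¹ • (x k - z k) ∈ opPrimal A b β ρ (z k) ∧
      ‖x (k + 1) - z k‖ ≤ √(σ k) * subproblemResidual A b β ρ σ ξ x k := by
  choose z hz hz' using fun k => exists_exact_step A b hβ hρ (h.sigma_pos' k) (x k)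
  refine ⟨z, fun k => ⟨hz k, ?_⟩⟩
  rw [h.subproblemResidual_eq b hβ hρ]
  exact hz' k _ _ _ (h.x_step k) (h.subgradAt hβ hρ k)

variable {z : ℕ → E n}

theorem norm_sub_exact_step_le (h : IsSsnalSequence A β ρ σ σInf ξ u x)
    (hA : CriterionA A b β ρ σ ξ x ε)
    (hz : ∀ k, ‖x (k + 1) - z k‖ ≤ √(σ k) * subproblemResidual A b β ρ σ ξ x k) (k : ℕ) :
    ‖x (k + 1) - z k‖ ≤ ε k := by
  refine (hz k).trans ?_
  have := hA.2.2 k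
  rwa [le_div_iff₀' (Real.sqrt_pos.2 (h.sigma_pos' k))] at this

theorem tendsto_norm_sub_exact (hβ : 0 < β) (hρ : 0 < ρ)
    (h : IsSsnalSequence A β ρ σ σInf ξ u x) (hA : CriterionA A b β ρ σ ξ x ε)
    (hz : ∀ k, (σ k)⁻¹ • (x k - z k) ∈ opPrimal A b β ρ (z k) ∧
      ‖x (k + 1) - z k‖ ≤ √(σ k) * subproblemResidual A b β ρ σ ξ x k) :
    Tendsto (fun k => ‖x k - z k‖) atTop (𝓝 0) :=
  tendsto_norm_sub_exact_step hA.1 hA.2.1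
    (fun k _ hy => exact_step_fejer (h.sigma_pos' k) (hz k).1 hy)
    (h.norm_sub_exact_step_le hA fun k => (hz k).2) (primalSolutions_nonempty A b hβ hρ)

theorem norm_inv_sigma_smul_le (h : IsSsnalSequence A β ρ σ σInf ξ u x) (k : ℕ) (y : E n) :
    ‖(σ k)⁻¹ • y‖ ≤ (σ 0)⁻¹ * ‖y‖ := by
  rw [norm_smul, norm_inv, Real.norm_eq_abs, abs_of_pos (h.sigma_pos' k)]
  exact mul_le_mul_of_nonneg_right
    (inv_anti₀ h.sigma_pos (h.sigma_mono (Nat.zero_le k))) (norm_nonneg y)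

theorem tendsto_inv_sigma_smul (h : IsSsnalSequence A β ρ σ σInf ξ u x) {y : ℕ → E n}
    (hy : Tendsto (fun k => ‖y k‖) atTop (𝓝 0)) :
    Tendsto (fun k => ‖(σ k)⁻¹ • y k‖) atTop (𝓝 0) :=
  squeeze_zero (fun _ => norm_nonneg _) (fun k => h.norm_inv_sigma_smul_le k (y k))
    (by simpa using hy.const_mul (σ 0)⁻¹)

theorem tendsto_x (hβ : 0 < β) (hρ : 0 < ρ) (h : IsSsnalSequence A β ρ σ σInf ξ u x)
    (hA : CriterionA A b β ρ σ ξ x ε) :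
    ∃ xs ∈ primalSolutions A b β ρ, Tendsto x atTop (𝓝 xs) := by
  obtain ⟨z, hz⟩ := h.exists_exact_steps b hβ hρ
  obtain ⟨a, ha, hf⟩ := exists_infDist_le_of_mem_opPrimal A b hβ hρ
  have hv := h.tendsto_inv_sigma_smul (h.tendsto_norm_sub_exact hβ hρ hA hz)
  refine exists_tendsto_of_quasiFejer hA.1 hA.2.1
    (fun k _ hy => exact_step_fejer (h.sigma_pos' k) (hz k).1 hy)
    (h.norm_sub_exact_step_le hA fun k => (hz k).2) (isClosed_primalSolutions A b β ρ)
    (primalSolutions_nonempty A b hβ hρ) ?_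
  refine squeeze_zero' (Eventually.of_forall fun _ => Metric.infDist_nonneg) ?_
    (by simpa using hv.const_mul a)
  filter_upwards [hv.eventually (ge_mem_nhds (half_pos hβ))] with k hk
  exact hf _ _ (hz k).1 hk

theorem tendsto_subproblemResidual (h : IsSsnalSequence A β ρ σ σInf ξ u x)
    (hA : CriterionA A b β ρ σ ξ x ε) :
    Tendsto (subproblemResidual A b β ρ σ ξ x) atTop (𝓝 0) := by
  refine squeeze_zero (g := fun k => ε k / √(σ 0)) (fun _ => norm_nonneg _) (fun k => ?_)
    (by simpa using hA.2.1.tendsto_atTop_zero.div_const (√(σ 0)))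
  refine (hA.2.2 k).trans ?_
  exact div_le_div_of_nonneg_left (hA.1 k) (Real.sqrt_pos.2 h.sigma_pos)
    (Real.sqrt_le_sqrt (h.sigma_mono (Nat.zero_le k)))

theorem tendsto_norm_dualResidual (h : IsSsnalSequence A β ρ σ σInf ξ u x) {xs : E n}
    (hx : Tendsto x atTop (𝓝 xs)) :
    Tendsto (fun k => ‖dualResidual A (ξ (k + 1)) (u (k + 1))‖) atTop (𝓝 0) := by
  have h1 := (hx.sub (hx.comp (tendsto_add_atTop_nat 1))).norm
  rw [sub_self, norm_zero] at h1
  refine (h.tendsto_inv_sigma_smul h1).congr fun k => ?_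
  congr 1
  rw [Function.comp_apply, h.x_step k, sub_sub_cancel, inv_smul_smul₀ (h.sigma_pos' k).ne']

theorem tendsto_dual (hβ : 0 < β) (hρ : 0 < ρ) (h : IsSsnalSequence A β ρ σ σInf ξ u x)
    (hA : CriterionA A b β ρ σ ξ x ε) {xs : E n} (hx : Tendsto x atTop (𝓝 xs)) :
    Tendsto ξ atTop (𝓝 (A.toEuclideanLin xs - b)) ∧
      Tendsto u atTop (𝓝 (-A.transpose.toEuclideanLin (A.toEuclideanLin xs - b))) := by
  have hres := h.tendsto_subproblemResidual hA
  rw [funext (h.subproblemResidual_eq b hβ hρ), ← tendsto_zero_iff_norm_tendsto_zero] at hres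
  have hAx : Tendsto (fun k => A.toEuclideanLin (x (k + 1))) atTop (𝓝 (A.toEuclideanLin xs)) :=
    ((continuous_toEuclideanLin A).tendsto xs).comp (hx.comp (tendsto_add_atTop_nat 1))
  have hξ : Tendsto (fun k => ξ (k + 1)) atTop (𝓝 (A.toEuclideanLin xs - b)) := by
    have := hres.add (hAx.sub_const b)
    rw [zero_add] at this
    exact this.congr fun k => by abel
  refine ⟨(tendsto_add_atTop_iff_nat 1).1 hξ, (tendsto_add_atTop_iff_nat 1).1 ?_⟩
  have hr := tendsto_zero_iff_norm_tendsto_zero.2 (h.tendsto_norm_dualResidual hx)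
  have hAξ := ((continuous_toEuclideanLin A.transpose).tendsto _).comp hξ
  have := hr.sub hAξ
  rw [zero_sub] at this
  exact this.congr fun k => by simp [dualResidual]

theorem eventually_infDist_le (hβ : 0 < β) (hρ : 0 < ρ)
    (h : IsSsnalSequence A β ρ σ σInf ξ u x) (hA : CriterionA A b β ρ σ ξ x ε) {δ : ℕ → ℝ}
    (hB : CriterionB1 A b β ρ σ ξ u x δ) {a : ℝ} (ha : IsPrimalModulus A b β ρ a) :
    ∀ᶠ k in atTop, Metric.infDist (x (k + 1)) (primalSolutions A b β ρ) ≤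
      primalRate a (σ k) (δ k) * Metric.infDist (x k) (primalSolutions A b β ρ) := by
  obtain ⟨z, hz⟩ := h.exists_exact_steps b hβ hρ
  have ha0 : 0 < a := ha.1
  obtain ⟨η, hη, hf⟩ := ha.infDist_le (primalSolutions_nonempty A b hβ hρ)
  have hv := h.tendsto_inv_sigma_smul (h.tendsto_norm_sub_exact hβ hρ hA hz)
  filter_upwards [hv.eventually (ge_mem_nhds hη),
    hB.2.1.tendsto_atTop_zero.eventually (gt_mem_nhds zero_lt_one)] with k hk hδ1
  have hσ := h.sigma_pos' k
  have hδ0 := hB.1 k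
  obtain ⟨y, hy, hxy⟩ := exists_mem_primalSolutions_norm_sub_eq A b hβ hρ (x k)
  have hfej := exact_step_fejer hσ (hz k).1 hy
  rw [← hxy] at hfej
  have hzd := hf _ _ (hz k).1 hk
  have hzy : Metric.infDist (z k) (primalSolutions A b β ρ) ≤ ‖z k - y‖ := by
    rw [← dist_eq_norm]; exact Metric.infDist_le_dist_of_mem hy
  have hxz : Metric.infDist (x (k + 1)) (primalSolutions A b β ρ) ≤
      Metric.infDist (z k) (primalSolutions A b β ρ) + ‖x (k + 1) - z k‖ := by
    rw [← dist_eq_norm]; exact Metric.infDist_le_infDist_add_dist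
  have hD0 : 0 ≤ Metric.infDist (z k) (primalSolutions A b β ρ) := Metric.infDist_nonneg
  have hd0 : 0 ≤ Metric.infDist (x k) (primalSolutions A b β ρ) := Metric.infDist_nonneg
  set d := Metric.infDist (x k) (primalSolutions A b β ρ)
  set D := Metric.infDist (z k) (primalSolutions A b β ρ)
  have hDd : D ≤ a / √(a ^ 2 + σ k ^ 2) * d := by
    rw [norm_smul, norm_inv, Real.norm_eq_abs, abs_of_pos hσ] at hzd
    have h1 : D * σ k ≤ a * ‖x k - z k‖ := by
      rw [← le_div_iff₀ hσ]
      exact hzd.trans_eq (by ring)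
    have h2 : (D * σ k) ^ 2 ≤ a ^ 2 * ‖x k - z k‖ ^ 2 := by
      rw [← mul_pow]; exact pow_le_pow_left₀ (by positivity) h1 2
    have h3 : D ^ 2 ≤ ‖z k - y‖ ^ 2 := pow_le_pow_left₀ hD0 hzy 2
    rw [div_mul_eq_mul_div, le_div_iff₀ (by positivity)]
    refine le_of_sq_le_sq ?_ (by positivity)
    rw [mul_pow, Real.sq_sqrt (by positivity)]
    have h4 := mul_le_mul_of_nonneg_left hfej (sq_nonneg a)
    have h5 := mul_le_mul_of_nonneg_left h3 (sq_nonneg a)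
    linarith
  have hstep : ‖x (k + 1) - z k‖ ≤ δ k * ‖x (k + 1) - x k‖ := by
    refine (hz k).2.trans ((mul_le_mul_of_nonneg_left (hB.2.2 k) (Real.sqrt_nonneg _)).trans_eq ?_)
    rw [h.norm_x_sub k]
    have := Real.mul_self_sqrt hσ.le
    linear_combination (δ k * ‖dualResidual A (ξ (k + 1)) (u (k + 1))‖) * this
  have hxzd : ‖x k - z k‖ ≤ d :=
    le_of_sq_le_sq (by nlinarith [sq_nonneg ‖z k - y‖]) hd0
  have htri : ‖x (k + 1) - x k‖ ≤ ‖x (k + 1) - z k‖ + ‖x k - z k‖ := by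
    rw [norm_sub_rev (x k)]
    exact norm_sub_le_norm_sub_add_norm_sub _ _ _
  have hμ : 0 ≤ a / √(a ^ 2 + σ k ^ 2) := by positivity
  set μ := a / √(a ^ 2 + σ k ^ 2) with hμdef
  have h1δ : 0 < 1 - δ k := sub_pos.2 hδ1
  have he : ‖x (k + 1) - x k‖ * (1 - δ k) ≤ d := by linarith
  have hfin : Metric.infDist (x (k + 1)) (primalSolutions A b β ρ) * (1 - δ k) ≤
      (μ + 2 * δ k) * d := by
    have h1 : Metric.infDist (x (k + 1)) (primalSolutions A b β ρ) ≤
        μ * d + δ k * ‖x (k + 1) - x k‖ := by linarith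
    have h2 := mul_le_mul_of_nonneg_right h1 h1δ.le
    have h3 := mul_le_mul_of_nonneg_left he hδ0
    have h4 : 0 ≤ μ * d * δ k := by positivity
    have h5 : 0 ≤ δ k * d := by positivity
    linarith
  rw [primalRate, ← hμdef, mul_right_comm, ← div_eq_mul_inv, le_div_iff₀ h1δ]
  exact hfin

theorem eventually_dual_le (hβ : 0 < β) (hρ : 0 < ρ)
    (h : IsSsnalSequence A β ρ σ σInf ξ u x) {δ' : ℕ → ℝ}
    (hB : CriterionB2 A b β ρ σ ξ u x δ') {a : ℝ} (ha : IsLagrangianModulus A b β ρ a)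
    {xs : E n} (hxs : xs ∈ primalSolutions A b β ρ) (hx : Tendsto x atTop (𝓝 xs)) :
    ∀ᶠ k in atTop, ‖(WithLp.toLp 2 (ξ (k + 1), u (k + 1)) -
        WithLp.toLp 2 (A.toEuclideanLin xs - b,
          -A.transpose.toEuclideanLin (A.toEuclideanLin xs - b)) : DualSpace m n)‖ ≤
      dualRate a (σ k) (δ' k) * ‖x (k + 1) - x k‖ := by
  have ha0 : 0 < a := ha.1
  obtain ⟨η, hη, hf⟩ := ha.infDist_le (saddlePoints_nonempty A b hβ hρ)
  have hlim : Tendsto (fun k => (1 + δ' k) * ‖dualResidual A (ξ (k + 1)) (u (k + 1))‖) atTop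
      (𝓝 0) := by
    simpa using (hB.2.1.const_add 1).mul (h.tendsto_norm_dualResidual hx)
  filter_upwards [hlim.eventually (ge_mem_nhds hη)] with k hk
  set w : TripleSpace m n := WithLp.toLp 2
    (WithLp.toLp 2 (ξ (k + 1) + b - A.toEuclideanLin (x (k + 1)), 0),
      dualResidual A (ξ (k + 1)) (u (k + 1))) with hw
  set p : TripleSpace m n := WithLp.toLp 2 (WithLp.toLp 2 (ξ (k + 1), u (k + 1)), x (k + 1))
    with hp
  have hwmem : w ∈ opLagrangian A b β ρ p :=
    (mem_opLagrangian_iff hβ hρ).2 ⟨rfl, by rw [add_zero]; exact h.subgradAt hβ hρ k, rfl⟩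
  have hwn : ‖w‖ ≤ (1 + δ' k) * ‖dualResidual A (ξ (k + 1)) (u (k + 1))‖ := by
    have h1 := (norm_le_norm_fst_add_norm_snd w).trans
      (add_le_add (norm_le_norm_fst_add_norm_snd w.fst) le_rfl)
    change _ ≤ ‖ξ (k + 1) + b - A.toEuclideanLin (x (k + 1))‖ + ‖(0 : E n)‖ +
      ‖dualResidual A (ξ (k + 1)) (u (k + 1))‖ at h1
    rw [norm_zero, ← h.subproblemResidual_eq b hβ hρ] at h1
    have := hB.2.2 k
    linarith
  have hdist := hf p w hwmem (hwn.trans hk)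
  have hle : ‖(WithLp.toLp 2 (ξ (k + 1), u (k + 1)) -
        WithLp.toLp 2 (A.toEuclideanLin xs - b,
          -A.transpose.toEuclideanLin (A.toEuclideanLin xs - b)) : DualSpace m n)‖ ≤
      Metric.infDist p (saddlePoints A b β ρ) := by
    refine (Metric.le_infDist (saddlePoints_nonempty A b hβ hρ)).2 fun q hq => ?_
    have hq1 := hq.1
    rw [dualSolutions_eq hβ hρ hxs, Set.mem_singleton_iff] at hq1
    rw [dist_eq_norm, ← hq1]
    exact norm_fst_le (p - q)
  refine hle.trans (hdist.trans ((mul_le_mul_of_nonneg_left hwn ha0.le).trans_eq ?_))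
  rw [dualRate, h.norm_x_sub k]
  have := (h.sigma_pos' k).ne'
  field_simp

end IsSsnalSequence

end Algorithm

end ClusteredLasso

theorem mainTheorem4 (m n : ℕ) (A : Matrix (Fin m) (Fin n) ℝ) (b : E m) (β ρ : ℝ)
    (hβ : 0 < β) (hρ : 0 < ρ) :
    -- the dual problem has a unique optimal solution, and the moduli `a_f`, `a_l` exist
    ∃ (ξs : E m) (us : E n),
      dualSolutions A b β ρ = {WithLp.toLp 2 (ξs, us)} ∧
      (∃ a_f, IsPrimalModulus A b β ρ a_f) ∧
      (∃ a_l, IsLagrangianModulus A b β ρ a_l) ∧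
      ∀ (σ : ℕ → ℝ) (σInf : ℝ≥0∞) (ξ : ℕ → E m) (u x : ℕ → E n) (ε : ℕ → ℝ),
        IsSsnalSequence A β ρ σ σInf ξ u x →
        CriterionA A b β ρ σ ξ x ε →
        -- global convergence under (A)
        ((∃ xs ∈ primalSolutions A b β ρ, Tendsto x atTop (𝓝 xs)) ∧
          Tendsto ξ atTop (𝓝 ξs) ∧ Tendsto u atTop (𝓝 us)) ∧
        ∀ δ : ℕ → ℝ, CriterionB1 A b β ρ σ ξ u x δ →
          -- primal linear rate under (A) and (B1)
          (∀ a_f, IsPrimalModulus A b β ρ a_f →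
            (∀ᶠ k in atTop,
              Metric.infDist (x (k + 1)) (primalSolutions A b β ρ) ≤
                primalRate a_f (σ k) (δ k) *
                  Metric.infDist (x k) (primalSolutions A b β ρ)) ∧
            Tendsto (fun k => primalRate a_f (σ k) (δ k)) atTop
              (𝓝 (primalRateLimit a_f σInf)) ∧
            primalRateLimit a_f σInf < 1) ∧
          -- dual rate under (A), (B1) and (B2)
          ∀ δ' : ℕ → ℝ, CriterionB2 A b β ρ σ ξ u x δ' →
            ∀ a_l, IsLagrangianModulus A b β ρ a_l →
              (∀ᶠ k in atTop,
                ‖(WithLp.toLp 2 (ξ (k + 1), u (k + 1)) - WithLp.toLp 2 (ξs, us) :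
                    DualSpace m n)‖ ≤
                  dualRate a_l (σ k) (δ' k) * ‖x (k + 1) - x k‖) ∧
              Tendsto (fun k => dualRate a_l (σ k) (δ' k)) atTop
                (𝓝 (dualRateLimit a_l σInf)) := by
  obtain ⟨x₀, hx₀⟩ := primalSolutions_nonempty A b hβ hρ
  refine ⟨_, _, dualSolutions_eq hβ hρ hx₀, exists_isPrimalModulus A b hβ hρ,
    exists_isLagrangianModulus A b hβ hρ, fun σ σInf ξ u x ε h hA => ?_⟩
  obtain ⟨xs, hxs, hx⟩ := h.tendsto_x hβ hρ hA
  have heq := (dualSolutions_eq hβ hρ hxs).symm.trans (dualSolutions_eq hβ hρ hx₀)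
  rw [Set.singleton_eq_singleton_iff, (WithLp.toLp_injective 2).eq_iff, Prod.mk.injEq] at heq
  rw [← heq.1]
  refine ⟨⟨⟨xs, hxs, hx⟩, h.tendsto_dual hβ hρ hA hx⟩, fun δ hB1 => ⟨fun a ha => ?_,
    fun δ' hB2 a ha => ?_⟩⟩
  · exact ⟨h.eventually_infDist_le hβ hρ hA hB1 ha,
      tendsto_primalRate a (fun k => (h.sigma_pos' k).le) h.sigmaInf_ne_zero h.sigma_tendsto
        hB1.2.1.tendsto_atTop_zero,
      primalRateLimit_lt_one ha.1 h.sigmaInf_ne_zero⟩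
  · exact ⟨h.eventually_dual_le hβ hρ hB2 ha hxs hx,
      tendsto_dualRate a (fun k => (h.sigma_pos' k).le) h.sigmaInf_ne_zero h.sigma_tendsto
        hB2.2.1⟩
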